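/- Let $\tau>0$, $\delta\in(0,1)$, $\Theta\in(0,\pi/4)$ and $\gamma\in[0,\delta/4)$. Let $D_\Theta\subset\mathbb C$ be the open rhombus with vertices $0$, $\pi$ and $\frac{\pi}{2}(1\pm i\tan\Theta)$, and let $A^2_\delta(D_\Theta)$ be the Hilbert space of holomorphic functions $f$ on $D_\Theta$ with $$\|f\|^2_{A^2_\delta(D_\Theta)}=\int_{D_\Theta}|f(s)|^2\,|s|^\delta|\pi-s|^\delta\,dA(s)<\infty ,$$ where $dA$ is the two-dimensional Lebesgue measure; such an $f$ is identified with its trace on $(0,\pi)$. For boundary data $u=(u_0,u_\pi)$ on $[0,\tau]$ let $z\in C([0,\tau];W^{-1,2}(0,\pi))$ be the (weak) solution of $$\partial_t z=\partial_x^2 z \ \text{ in } (0,\tau)\times(0,\pi),\qquad z(t,0)=u_0(t),\quad z(t,\pi)=u_\pi(t),\qquad z(0,\cdot)=0,$$ and let $\Phi^D_\tau u=z(\tau,\cdot)$. For $u\in L^2([0,\tau];\mathbb C^2)$ put $u_\gamma(\sigma)=(\tau-\sigma)^{-\gamma}u(\sigma)$; for the data $u_\gamma$ the solution exists and is unique.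 For $\kappa\in\{\tau/(2\pi),\,2\pi/\tau\}$ and $n\in\mathbb Z$ let $\mathrm e_{n}(t)=(\tau-t)^{-\gamma}e^{in\kappa t}$ on $[0,\tau]$. Then, for each of the two values of $\kappa$, $\Phi^D_\tau(\mathrm e_n,0)$ and $\Phi^D_\tau(0,\mathrm e_n)$ belong to $A^2_\delta(D_\Theta)$ for every $n$, and $$\sum_{n\in\mathbb Z}\left\|\Phi^D_\tau\begin{pmatrix}\mathrm e_{n}\\0\end{pmatrix}\right\|^2_{A^2_\delta(D_\Theta)}+\sum_{n\in\mathbb Z}\left\|\Phi^D_\tau\begin{pmatrix}0\\\mathrm e_{n}\end{pmatrix}\right\|^2_{A^2_\delta(D_\Theta)}<\infty .$$ Moreover, the map $L^D_\tau u=\Phi^D_\tau(u_\gamma)$ is a Hilbert–Schmidt operator from $L^2([0,\tau];\mathbb C^2)$ to $A^2_\delta(D_\Theta)$. -/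

import Mathlib

open MeasureTheory Set Complex
open scoped ENNReal ContDiff

noncomputable section

namespace DirichletHeat

/-! ## The negative Sobolev space on the interval `(0, π)` -/

/-- Complex-valued smooth functions vanishing at `0` and at `π`. -/
def testSubmodule : Submodule ℂ (ℝ → ℂ) where
  carrier := {φ | ContDiff ℝ ∞ φ ∧ φ 0 = 0 ∧ φ Real.pi = 0}
  add_mem' := by
    rintro f g ⟨hf, hf0, hf1⟩ ⟨hg, hg0, hg1⟩
    exact ⟨hf.add hg, by simp [hf0, hg0], by simp [hf1, hg1]⟩
  zero_mem' := ⟨contDiff_const, rfl, rfl⟩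
  smul_mem' := by
    rintro c f ⟨hf, hf0, hf1⟩
    exact ⟨contDiff_const.smul hf, by simp [hf0], by simp [hf1]⟩

/-- The functions of `testSubmodule`, as a type which will carry the norm of `W₀^{1,2}(0, π)`,
`‖φ‖ = ‖φ'‖_{L²(0, π)}`. It contains `C_c^∞(0, π)` and its restrictions to `(0, π)` lie in
`W₀^{1,2}(0, π)`, so it is dense in `W₀^{1,2}(0, π)`. -/
def Test : Type := testSubmodule

instance : AddCommGroup Test := inferInstanceAs (AddCommGroup testSubmodule)

instance : Module ℂ Test := inferInstanceAs (Module ℂ testSubmodule)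

instance : CoeFun Test (fun _ => ℝ → ℂ) := ⟨fun φ => φ.1⟩

theorem Test.contDiff (φ : Test) : ContDiff ℝ ∞ (φ : ℝ → ℂ) := φ.2.1

theorem Test.differentiable (φ : Test) : Differentiable ℝ (φ : ℝ → ℂ) :=
  φ.contDiff.differentiable (by simp)

theorem Test.memLp_deriv (φ : Test) :
    MemLp (deriv (φ : ℝ → ℂ)) 2 (volume.restrict (Icc 0 Real.pi)) := by
  have hc : Continuous (deriv (φ : ℝ → ℂ)) := φ.contDiff.continuous_deriv (by simp)
  obtain ⟨C, hC⟩ := isCompact_Icc.exists_bound_of_continuousOn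
    (hc.continuousOn (s := Icc (0 : ℝ) Real.pi))
  refine MemLp.of_bound hc.aestronglyMeasurable C ?_
  exact (ae_restrict_iff' measurableSet_Icc).2 (Filter.Eventually.of_forall hC)

/-- The derivative, as a map into `L²(0, π)`. -/
def Test.derivL2 : Test →ₗ[ℂ] Lp ℂ 2 (volume.restrict (Icc 0 Real.pi)) where
  toFun φ := φ.memLp_deriv.toLp _
  map_add' φ ψ := by
    rw [← MemLp.toLp_add]
    congr 1
    funext x
    exact deriv_add (φ.differentiable x) (ψ.differentiable x)
  map_smul' c φ := by
    rw [RingHom.id_apply, ← MemLp.toLp_const_smul]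
    congr 1
    funext x
    exact deriv_const_smul c (φ.differentiable x)

instance : SeminormedAddCommGroup Test :=
  SeminormedAddCommGroup.induced Test _ Test.derivL2

instance : NormedSpace ℂ Test :=
  NormedSpace.induced ℂ Test _ Test.derivL2

/-- `W^{-1,2}(0, π)`: the dual of `W₀^{1,2}(0, π)` with its dual norm. A bounded functional on
`W₀^{1,2}(0, π)` is the same as a bounded functional on the dense subspace `Test`. The pairing
is bilinear (no complex conjugation). -/
abbrev WNeg : Type := StrongDual ℂ Test

/-! ## The heat equation with Dirichlet boundary inputs -/

/-- `z : [0, τ] → W^{-1,2}(0, π)` is the solution of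
`∂_t z = ∂_x² z`, `z(t, 0) = u₀(t)`, `z(t, π) = u_π(t)`, `z(0, ·) = 0`, where
`u = (u₀, u_π)`: it is continuous with values in `W^{-1,2}(0, π)`, and the equation
`z' = A z + B u` with `B (v₀, v_π) = - v₀ δ₀' + v_π δ_π'` holds, integrated in time, in the dual
of the domain `{φ | φ(0) = φ(π) = 0 = φ''(0) = φ''(π)}`. -/
structure IsSolution (τ : ℝ) (u : ℝ → EuclideanSpace ℂ (Fin 2)) (z : ℝ → WNeg) : Prop where
  integrable : IntegrableOn u (Icc 0 τ)
  continuousOn : ContinuousOn z (Icc 0 τ)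
  initial : z 0 = 0
  equation : ∀ φ ψ : Test, (∀ x, ψ x = deriv (deriv φ) x) → ∀ t ∈ Icc 0 τ,
    z t φ = ∫ σ in (0 : ℝ)..t,
      (z σ ψ + u σ 0 * deriv φ 0 - u σ 1 * deriv φ Real.pi)

open Classical in
/-- The Dirichlet input map: `Φ_τ u = z(τ, ·) ∈ W^{-1,2}(0, π)`, for `z` the solution with boundary
data `u = (u₀, u_π)` (and the value `0` for data for which there is no solution). -/
def inputMap (τ : ℝ) (u : ℝ → EuclideanSpace ℂ (Fin 2)) : WNeg :=
  if h : ∃ z, IsSolution τ u z then h.choose τ else 0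

/-- The weighted input `u_γ(σ) = (τ - σ)^{-γ} u(σ)`. -/
def weighted (τ γ : ℝ) (u : ℝ → EuclideanSpace ℂ (Fin 2)) (σ : ℝ) :
    EuclideanSpace ℂ (Fin 2) :=
  (((τ - σ) ^ (-γ) : ℝ) : ℂ) • u σ

/-- The input space `L²([0, τ]; ℂ²)`. -/
abbrev InputSpace (τ : ℝ) : Type :=
  Lp (EuclideanSpace ℂ (Fin 2)) 2 (volume.restrict (Icc 0 τ))

/-! ## The weighted Bergman space on the rhombus -/

/-- The open rhombus with vertices `0`, `π` and `(π / 2) (1 ± i tan Θ)`. -/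
def rhombus (Θ : ℝ) : Set ℂ :=
  {s | |s.im| < Real.tan Θ * s.re ∧ |s.im| < Real.tan Θ * (Real.pi - s.re)}

/-- The measure `ρ_δ dA` on the rhombus, `ρ_δ(s) = |s|^δ |π - s|^δ`. -/
def bergmanMeasure (δ Θ : ℝ) : Measure ℂ :=
  (volume.restrict (rhombus Θ)).withDensity
    fun s => ENNReal.ofReal (‖s‖ ^ δ * ‖(Real.pi : ℂ) - s‖ ^ δ)

/-- The weighted Bergman space `A²_δ(D_Θ)`: the classes in `L²(D_Θ, ρ_δ dA)` of functions which are
holomorphic on `D_Θ`, with the inner product of `L²(D_Θ, ρ_δ dA)`. -/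
def bergman (δ Θ : ℝ) : Submodule ℂ (Lp ℂ 2 (bergmanMeasure δ Θ)) where
  carrier := {f | ∃ g : ℂ → ℂ, DifferentiableOn ℂ g (rhombus Θ) ∧
    f =ᵐ[bergmanMeasure δ Θ] g}
  add_mem' := by
    rintro f₁ f₂ ⟨g₁, h₁, e₁⟩ ⟨g₂, h₂, e₂⟩
    exact ⟨g₁ + g₂, h₁.add h₂, (Lp.coeFn_add f₁ f₂).trans (e₁.add e₂)⟩
  zero_mem' := ⟨0, differentiableOn_const 0, Lp.coeFn_zero _ _ _⟩
  smul_mem' := by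
    rintro c f ⟨g, h, e⟩
    exact ⟨c • g, h.const_smul c, (Lp.coeFn_smul c f).trans (e.const_smul c)⟩

/-- The identification of an element of `A²_δ(D_Θ)` with its trace on `(0, π)`: the holomorphic
function `g` in the class `f`, restricted to `(0, π)`, is the distribution `ℓ`. -/
def IsTrace {δ Θ : ℝ} (f : bergman δ Θ) (ℓ : WNeg) : Prop :=
  ∃ g : ℂ → ℂ, DifferentiableOn ℂ g (rhombus Θ) ∧
    (f : Lp ℂ 2 (bergmanMeasure δ Θ)) =ᵐ[bergmanMeasure δ Θ] g ∧
    ∀ φ : Test, tsupport φ ⊆ Ioo 0 Real.pi →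
      ℓ φ = ∫ x in (0 : ℝ)..Real.pi, g (x : ℂ) * φ x

/-! ## Hilbert–Schmidt operators -/

/-- A bounded operator `T` is Hilbert–Schmidt if `∑ ‖T bᵢ‖² < ∞` for every orthonormal
basis `b`. -/
def IsHilbertSchmidt {H K : Type} [NormedAddCommGroup H] [InnerProductSpace ℂ H]
    [NormedAddCommGroup K] [InnerProductSpace ℂ K] (T : H →L[ℂ] K) : Prop :=
  ∀ (ι : Type) (b : HilbertBasis ι ℂ H), Summable fun i => ‖T (b i)‖ ^ 2

/-- `(τ - t)^{-γ} e^{i n κ t}`. -/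
def weightedExp (τ γ κ : ℝ) (n : ℤ) (t : ℝ) : ℂ :=
  (((τ - t) ^ (-γ) : ℝ) : ℂ) * exp (I * n * κ * t)

end DirichletHeat

end

/-!
The solution is given by Duhamel's formula. Let `S(r)` be the Dirichlet heat semigroup on `(0, π)`.
Tested against `φ`, the response at time `t` to the boundary value `v` at the endpoint `0` is
`∫₀ᵗ v(σ) ∂ₓ(S(t - σ)φ)(0) dσ`, and the endpoint `π` is reduced to this one by the reflection
`x ↦ π - x`. In the sine basis, the functional `φ ↦ ∂ₓ(S(r)φ)(0)` is
`boundaryFlux r = (1/π) ∑ₙ e^{-n²r} Cₙ`, where `Cₙφ = ∫ cos(nx) φ'(x) dx`. Bessel's inequality gives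
`‖boundaryFlux r‖ ≤ C r^{-α}` in `W^{-1,2}` for every `α > 1/4`. Since `γ < 1/4`, one may choose `α`
with `α + γ < 1/2`; then Duhamel's integral of `(τ - σ)^{-γ} w(σ)`, `w ∈ L²`, converges and is
continuous in `t` (`continuousOn_integral_weightedScalar_smul`). It solves the equation because
`boundaryFlux r φ = φ'(0) + ∫₀ʳ boundaryFlux ρ φ'' dρ` (`fluxSeries_eq_add_integral`). The solution
is unique because each sine coefficient of a difference of solutions solves `a' = -n²a`, `a(0) = 0`,
and the sines span a dense space of test functions (`IsSolution.eqOn`).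

At positive times `boundaryFlux r` is integration against the Poisson kernel `K(r, x)`, up to
a constant the `x`-derivative of a Jacobi theta function, hence entire in `x`. The functional equation of the theta
function writes `K` as a sum of Gaussians centred at `2πn`. In a sector `|Im s| ≤ q Re s` with
`q < 1`, where `Re s²` is comparable with `|s|²`, it yields
`|K(r, s)| ≤ C r^{(p-3)/2} (Re s)^{1-p}` for every `p > 2` (`exists_norm_poissonKernel_le`). For
`p = 2 + γ + δ/4` the square of this bound, times `(τ - σ)^{-2γ}` with `r = τ - σ`, is integrable over
`σ ∈ (0, τ)`, and it is integrable over the rhombus with the weight `|s|^δ |π - s|^δ`; this is where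
`γ < δ/4` is used.

So the final state is the trace of `s ↦ ⟪κ_s, u⟫`, with a kernel `κ_s ∈ L²(0, τ; ℂ²)` such that
`∫ ‖κ_s‖² dμ(s) < ∞` (`Admissible.exists_kernel_bound`). This gives boundedness, and Bessel's
inequality in `u`, applied for fixed `s` and integrated over the rhombus, gives the Hilbert–Schmidt
property. The exponentials `e^{inκt}` satisfy a Bessel inequality on `[0, τ]` for every `κ > 0`
(`exists_tsum_enorm_integral_mul_exp_le`), which gives the two series in the same way.
-/

noncomputable section

namespace DirichletHeat

/-! ### The Poisson kernel of the heat equation on the interval -/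

/-- The kernel `K(r, s) = (1/π) ∑ₙ n sin(ns) e^{-n²r}`, `n ∈ ℤ`, which maps a boundary value at the
endpoint `0` to the temperature at the point `s` after time `r`. It is written through the
derivative of the Jacobi theta function, so that it is `0` for `r ≤ 0`. -/
def poissonKernel (r : ℝ) (s : ℂ) : ℂ :=
  -(1 / (2 * (Real.pi : ℂ) ^ 2)) * jacobiTheta₂' (s / (2 * Real.pi)) (I * (r / Real.pi))

theorem im_I_mul_div_pi (r : ℝ) : (I * (r / Real.pi : ℂ)).im = r / Real.pi := by
  rw [← ofReal_div, I_mul_im, ofReal_re]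

theorem im_I_mul_div_pi_pos {r : ℝ} (hr : 0 < r) : 0 < (I * (r / Real.pi : ℂ)).im := by
  rw [im_I_mul_div_pi]; exact div_pos hr Real.pi_pos

theorem poissonKernel_of_nonpos {r : ℝ} (hr : r ≤ 0) (s : ℂ) : poissonKernel r s = 0 := by
  rw [poissonKernel, jacobiTheta₂'_undef, mul_zero]
  rw [im_I_mul_div_pi]
  exact div_nonpos_of_nonpos_of_nonneg hr Real.pi_pos.le

theorem continuousOn_poissonKernel :
    ContinuousOn (fun p : ℝ × ℂ => poissonKernel p.1 p.2) {p | 0 < p.1} := by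
  rintro ⟨r, s⟩ hr
  refine ContinuousAt.continuousWithinAt ?_
  refine ContinuousAt.mul continuousAt_const ?_
  have h := continuousAt_jacobiTheta₂' (s / (2 * Real.pi)) (im_I_mul_div_pi_pos hr)
  exact ContinuousAt.comp (f := fun p : ℝ × ℂ => (p.2 / (2 * Real.pi : ℂ), I * (p.1 / Real.pi : ℂ)))
    (x := (r, s)) h (by fun_prop)

theorem measurable_poissonKernel : Measurable (fun p : ℝ × ℂ => poissonKernel p.1 p.2) := by
  classical
  have hm : MeasurableSet {p : ℝ × ℂ | 0 < p.1} := measurableSet_lt measurable_const measurable_fst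
  have h := continuousOn_poissonKernel.measurable_piecewise (g := fun _ => 0)
    continuousOn_const hm
  convert h using 1
  funext p
  by_cases hp : 0 < p.1
  · rw [piecewise_eq_of_mem (hi := show p ∈ {p : ℝ × ℂ | 0 < p.1} from hp)]
  · rw [piecewise_eq_of_notMem (hi := show p ∉ {p : ℝ × ℂ | 0 < p.1} from hp),
      poissonKernel_of_nonpos (not_lt.1 hp)]

/-- The eigenfunction expansion; the exponential series of the theta function is symmetrized under
`n ↦ -n`. -/
theorem hasSum_poissonKernel {r : ℝ} (hr : 0 < r) (s : ℂ) :
    HasSum (fun n : ℤ => 1 / (Real.pi : ℂ) * (exp (-(n : ℂ) ^ 2 * r) * (n * sin (n * s))))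
      (poissonKernel r s) := by
  have h := hasSum_jacobiTheta₂'_term (s / (2 * Real.pi)) (im_I_mul_div_pi_pos hr)
  have h2 := ((Equiv.neg ℤ).hasSum_iff.2 h)
  have h3 := ((h.add h2).mul_left (-(1 / (2 * (Real.pi : ℂ) ^ 2)))).div_const 2
  have hpi : (Real.pi : ℂ) ≠ 0 := ofReal_ne_zero.2 Real.pi_ne_zero
  convert! h3 using 1
  · funext n
    have e1 : jacobiTheta₂'_term n (s / (2 * Real.pi)) (I * (r / Real.pi))
        = 2 * Real.pi * I * n * (exp (-(n : ℂ) ^ 2 * r) * exp (n * s * I)) := by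
      rw [jacobiTheta₂'_term, jacobiTheta₂_term, ← Complex.exp_add]
      congr 2
      field_simp
      linear_combination (n : ℂ) ^ 2 * r * I_sq
    have e2 : jacobiTheta₂'_term (-n) (s / (2 * Real.pi)) (I * (r / Real.pi))
        = -(2 * Real.pi * I * n) * (exp (-(n : ℂ) ^ 2 * r) * exp (-(n * s) * I)) := by
      rw [jacobiTheta₂'_term, jacobiTheta₂_term, ← Complex.exp_add]
      push_cast
      have : 2 * (Real.pi : ℂ) * I * -(n : ℂ) * (s / (2 * Real.pi))
          + Real.pi * I * (-(n : ℂ)) ^ 2 * (I * (r / Real.pi))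
          = -(n : ℂ) ^ 2 * r + -(n * s) * I := by
        field_simp
        linear_combination (n : ℂ) ^ 2 * r * I_sq
      rw [this]; ring
    simp only [Function.comp_apply, Equiv.neg_apply]
    rw [e1, e2, Complex.sin]
    field_simp
    ring
  · rw [poissonKernel]; ring

/-- The expansion of the kernel by the method of images, which is the functional equation of the
theta function. -/
theorem hasSum_poissonKernel_image {r : ℝ} (hr : 0 < r) (s : ℂ) :
    HasSum (fun n : ℤ => ((Real.sqrt (Real.pi / r) / (2 * Real.pi * r) : ℝ) : ℂ) *
      (s - 2 * Real.pi * n) * exp (-(s - 2 * Real.pi * n) ^ 2 / (4 * r)))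
      (poissonKernel r s) := by
  have hpi : (Real.pi : ℂ) ≠ 0 := ofReal_ne_zero.2 Real.pi_ne_zero
  have hrc : (r : ℂ) ≠ 0 := ofReal_ne_zero.2 hr.ne'
  set z : ℂ := s / (2 * Real.pi) with hz
  set w : ℂ := I * (r / Real.pi) with hw
  have hw0 : w ≠ 0 := mul_ne_zero I_ne_zero (div_ne_zero hrc hpi)
  have him : 0 < (-1 / w).im := by
    have : -1 / w = ((Real.pi / r : ℝ) : ℂ) * I := by
      rw [hw]; push_cast; field_simp; rw [I_sq]
    rw [this, im_ofReal_mul, I_im, mul_one]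
    exact div_pos Real.pi_pos hr
  have hpow : 1 / (-I * w) ^ (1 / 2 : ℂ) = ((Real.sqrt (Real.pi / r) : ℝ) : ℂ) := by
    have : -I * w = ((r / Real.pi : ℝ) : ℂ) := by
      rw [hw, ← mul_assoc, neg_mul, I_mul_I, neg_neg, one_mul, ofReal_div]
    rw [this, show (1 / 2 : ℂ) = ((1 / 2 : ℝ) : ℂ) by push_cast; rfl,
      ← ofReal_cpow (div_pos hr Real.pi_pos).le, ← ofReal_one, ← ofReal_div, ← Real.sqrt_eq_rpow,
      ← Real.sqrt_one, ← Real.sqrt_div zero_le_one, one_div_div]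
  have h1 := hasSum_jacobiTheta₂'_term (z / w) him
  have h2 := (hasSum_jacobiTheta₂_term (z / w) him).mul_left (2 * Real.pi * I * z)
  have h3 := (h1.sub h2).mul_left (-(1 / (2 * (Real.pi : ℂ) ^ 2)) *
    (1 / (-I * w) ^ (1 / 2 : ℂ) * exp (-Real.pi * I * z ^ 2 / w) / w))
  convert! h3 using 1
  · funext n
    rw [hpow, jacobiTheta₂'_term, jacobiTheta₂_term]
    have e : exp (-(s - 2 * Real.pi * n) ^ 2 / (4 * r)) = exp (-Real.pi * I * z ^ 2 / w) *
        exp (2 * Real.pi * I * n * (z / w) + Real.pi * I * n ^ 2 * (-1 / w)) := by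
      rw [← Complex.exp_add, hz, hw]
      congr 1
      field_simp
      ring
    rw [e, hz, hw]
    push_cast
    field_simp
    ring
  · rw [poissonKernel, jacobiTheta₂'_functional_equation]
    ring

theorem differentiable_poissonKernel (r : ℝ) : Differentiable ℂ (poissonKernel r) := by
  rcases le_or_gt r 0 with hr | hr
  · have : poissonKernel r = fun _ => 0 := funext fun s => poissonKernel_of_nonpos hr s
    rw [this]; exact differentiable_const _
  · have h : Differentiable ℂ fun z => jacobiTheta₂ z (I * (r / Real.pi)) := fun z =>
      differentiableAt_jacobiTheta₂_fst z (im_I_mul_div_pi_pos hr)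
    have h' : (fun z => jacobiTheta₂' z (I * (r / Real.pi)))
        = deriv fun z => jacobiTheta₂ z (I * (r / Real.pi)) := by
      funext z
      exact (hasDerivAt_jacobiTheta₂_fst z (im_I_mul_div_pi_pos hr)).deriv.symm
    have h2 : Differentiable ℂ fun z => jacobiTheta₂' z (I * (r / Real.pi)) := by
      rw [h']; exact h.deriv
    exact (h2.comp (differentiable_id.div_const (2 * Real.pi : ℂ))).const_mul _

theorem exp_neg_le_rpow {β : ℝ} (hβ : 0 < β) {v : ℝ} (hv : 0 < v) :
    Real.exp (-v) ≤ β ^ β * v ^ (-β) := by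
  have h1 : v / β ≤ Real.exp (v / β) := by linarith [Real.add_one_le_exp (v / β)]
  have h2 : (v / β) ^ β ≤ Real.exp v := by
    calc (v / β) ^ β ≤ Real.exp (v / β) ^ β := Real.rpow_le_rpow (by positivity) h1 hβ.le
      _ = Real.exp v := by rw [← Real.exp_mul, div_mul_cancel₀ _ hβ.ne']
  rw [Real.exp_neg, Real.rpow_neg hv.le, ← div_eq_mul_inv, inv_le_comm₀ (Real.exp_pos _)
    (by positivity), inv_div, ← Real.div_rpow hv.le hβ.le]
  exact h2

theorem summable_max_one_abs_rpow {b : ℝ} (hb : 1 < b) :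
    Summable fun n : ℤ => (max 1 |(n : ℝ)|) ^ (-b) := by
  refine (Real.summable_abs_int_rpow hb).of_norm_bounded_eventually ?_
  have : ∀ᶠ n : ℤ in Filter.cofinite, n ≠ 0 := by
    simpa using (Set.finite_singleton (0 : ℤ)).eventually_cofinite_notMem
  filter_upwards [this] with n hn
  have h1 : (1 : ℝ) ≤ |(n : ℝ)| := by exact_mod_cast Int.one_le_abs hn
  rw [max_eq_right h1, Real.norm_of_nonneg (by positivity)]

/-- The bound on the kernel in a sector: each Gaussian of the image expansion is replaced by a power,
and the distance of `Re s` to the `n`-th centre is at least `max 1 |n| * Re s`. -/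
theorem exists_norm_poissonKernel_le {q p : ℝ} (hq0 : 0 ≤ q) (hq : q < 1) (hp : 2 < p) :
    ∃ C : ℝ, 0 ≤ C ∧ ∀ r : ℝ, 0 < r → ∀ s : ℂ, 0 < s.re → s.re < Real.pi →
      |s.im| ≤ q * s.re → ‖poissonKernel r s‖ ≤ C * r ^ ((p - 3) / 2) * s.re ^ (1 - p) := by
  have hpi := Real.pi_pos
  set S := ∑' n : ℤ, (max 1 |(n : ℝ)|) ^ (-(p - 1)) with hS
  have hsum := summable_max_one_abs_rpow (b := p - 1) (by linarith)
  set c := (1 - q ^ 2) / 4 with hc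
  have hc0 : 0 < c := by rw [hc]; nlinarith
  set D := Real.sqrt Real.pi / Real.pi * ((p / 2) ^ (p / 2) * c ^ (-(p / 2))) with hD
  have hD0 : 0 ≤ D := by positivity
  refine ⟨D * S, mul_nonneg hD0 (tsum_nonneg fun n => by positivity), ?_⟩
  intro r hr s hs0 hs1 hs
  have key : ∀ n : ℤ, ‖((Real.sqrt (Real.pi / r) / (2 * Real.pi * r) : ℝ) : ℂ) *
      (s - 2 * Real.pi * n) * exp (-(s - 2 * Real.pi * n) ^ 2 / (4 * r))‖ ≤
      D * r ^ ((p - 3) / 2) * s.re ^ (1 - p) * (max 1 |(n : ℝ)|) ^ (-(p - 1)) := by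
    intro n
    set a := |s.re - 2 * Real.pi * n| with ha
    have hre : (s - 2 * Real.pi * n).re = s.re - 2 * Real.pi * n := by simp
    have him : (s - 2 * Real.pi * n).im = s.im := by simp
    have hmax : max 1 |(n : ℝ)| * s.re ≤ a := by
      rcases eq_or_ne n 0 with rfl | hn
      · simp [ha, abs_of_pos hs0]
      · have h1 : (1 : ℝ) ≤ |(n : ℝ)| := by exact_mod_cast Int.one_le_abs hn
        rw [max_eq_right h1, ha]
        have h2 : 2 * Real.pi * |(n : ℝ)| - s.re ≤ |s.re - 2 * Real.pi * n| := by
          have := abs_sub_abs_le_abs_sub (2 * Real.pi * (n : ℝ)) s.re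
          rw [abs_mul, abs_of_pos (by positivity : 0 < 2 * Real.pi), abs_of_pos hs0,
            abs_sub_comm] at this
          exact this
        refine le_trans ?_ h2
        nlinarith
    have hM : 1 ≤ max 1 |(n : ℝ)| := le_max_left _ _
    have hxa : s.re ≤ a := le_trans (by nlinarith) hmax
    have ha0 : 0 < a := hs0.trans_le hxa
    have hima : |s.im| ≤ q * a := hs.trans (by gcongr)
    have hn1 : ‖s - 2 * Real.pi * n‖ ≤ 2 * a := by
      refine (Complex.norm_le_abs_re_add_abs_im _).trans ?_
      rw [hre, him, ← ha]
      nlinarith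
    have hn2 : ‖exp (-(s - 2 * Real.pi * n) ^ 2 / (4 * r))‖ ≤
        (p / 2) ^ (p / 2) * c ^ (-(p / 2)) * (a ^ (-p) * r ^ (p / 2)) := by
      rw [Complex.norm_exp]
      have e1 : (-(s - 2 * Real.pi * n) ^ 2 / (4 * r)).re = -((a ^ 2 - s.im ^ 2) / (4 * r)) := by
        rw [show (4 * r : ℂ) = ((4 * r : ℝ) : ℂ) by push_cast; rfl, Complex.div_ofReal_re, neg_re, sq,
          mul_re, hre, him, ha, sq_abs]
        ring
      rw [e1]
      have e2 : c * a ^ 2 / r ≤ (a ^ 2 - s.im ^ 2) / (4 * r) := by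
        rw [div_le_div_iff₀ hr (by positivity)]
        have : s.im ^ 2 ≤ q ^ 2 * a ^ 2 := by
          rw [← sq_abs s.im, ← mul_pow]; gcongr
        have h4 : c * a ^ 2 * 4 ≤ a ^ 2 - s.im ^ 2 := by rw [hc]; nlinarith
        nlinarith
      have e3 : 0 < c * a ^ 2 / r := by positivity
      refine (Real.exp_le_exp.2 (neg_le_neg e2)).trans ((exp_neg_le_rpow (β := p / 2) (by linarith)
        e3).trans (le_of_eq ?_))
      rw [Real.div_rpow (by positivity) hr.le, Real.mul_rpow hc0.le (by positivity),
        ← Real.rpow_natCast, ← Real.rpow_mul ha0.le, Real.rpow_neg hr.le (p / 2), div_inv_eq_mul,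
        show ((2 : ℕ) : ℝ) * (-(p / 2)) = -p by push_cast; ring]
      ring
    have hpow : a ^ (1 - p) ≤ (max 1 |(n : ℝ)|) ^ (-(p - 1)) * s.re ^ (1 - p) := by
      rw [neg_sub, ← Real.mul_rpow (by positivity) hs0.le]
      exact Real.rpow_le_rpow_of_nonpos (by positivity) hmax (by linarith)
    have hfac : Real.sqrt (Real.pi / r) / (2 * Real.pi * r) * (2 * a) *
        ((p / 2) ^ (p / 2) * c ^ (-(p / 2)) * (a ^ (-p) * r ^ (p / 2))) =
        D * r ^ ((p - 3) / 2) * a ^ (1 - p) := by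
      have r1 : r ^ ((p - 3) / 2) = r ^ (p / 2) / (Real.sqrt r * r) := by
        rw [show (p - 3) / 2 = p / 2 - (1 / 2 + 1) by ring, Real.rpow_sub hr,
          Real.rpow_add hr, Real.rpow_one, Real.sqrt_eq_rpow]
      have r2 : a ^ (1 - p) = a * a ^ (-p) := by
        rw [sub_eq_add_neg, Real.rpow_add ha0, Real.rpow_one]
      rw [r1, r2, Real.sqrt_div hpi.le, hD]
      have : Real.sqrt r ≠ 0 := (Real.sqrt_pos.2 hr).ne'
      field_simp
    rw [norm_mul, norm_mul, norm_real, Real.norm_of_nonneg (by positivity)]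
    calc _ ≤ Real.sqrt (Real.pi / r) / (2 * Real.pi * r) * (2 * a) *
        ((p / 2) ^ (p / 2) * c ^ (-(p / 2)) * (a ^ (-p) * r ^ (p / 2))) := by gcongr
      _ = D * r ^ ((p - 3) / 2) * a ^ (1 - p) := hfac
      _ ≤ D * r ^ ((p - 3) / 2) * ((max 1 |(n : ℝ)|) ^ (-(p - 1)) * s.re ^ (1 - p)) := by gcongr
      _ = _ := by ring
  have h := hasSum_poissonKernel_image hr s
  rw [← h.tsum_eq]
  refine (tsum_of_norm_bounded (hsum.hasSum.mul_left _) key).trans (le_of_eq ?_)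
  rw [hS]; ring

/-! ### Square integrable functions and Bessel's inequality -/

theorem enorm_sq_eq_ofReal {E : Type*} [SeminormedAddCommGroup E] (x : E) :
    ‖x‖ₑ ^ 2 = ENNReal.ofReal (‖x‖ ^ 2) := by
  rw [ENNReal.ofReal_pow (norm_nonneg _), ofReal_norm]

theorem lintegral_enorm_sq_eq {α E : Type*} [MeasurableSpace α] {μ : Measure α}
    [NormedAddCommGroup E] {f : α → E} (hf : MemLp f 2 μ) :
    ∫⁻ x, ‖f x‖ₑ ^ 2 ∂μ = ENNReal.ofReal (∫ x, ‖f x‖ ^ 2 ∂μ) := by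
  rw [ofReal_integral_eq_lintegral_ofReal
    ((memLp_two_iff_integrable_sq_norm hf.aestronglyMeasurable).1 hf)
    (Filter.Eventually.of_forall fun x => sq_nonneg _)]
  simp_rw [enorm_sq_eq_ofReal]

theorem enorm_toLp_sq {α E : Type*} [MeasurableSpace α] {μ : Measure α}
    [NormedAddCommGroup E] {f : α → E} (hf : MemLp f 2 μ) :
    ‖hf.toLp f‖ₑ ^ 2 = ∫⁻ x, ‖f x‖ₑ ^ 2 ∂μ := by
  rw [Lp.enorm_toLp, eLpNorm_eq_lintegral_rpow_enorm_toReal two_ne_zero ENNReal.ofNat_ne_top,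
    ← ENNReal.rpow_natCast, ← ENNReal.rpow_mul]
  simp

/-- Bessel's inequality for the exponentials `e^{inκt}` on `[0, τ]`, for arbitrary `κ > 0`. They
need not be orthogonal, but a multiple `M * 2π/κ` of their period exceeds `τ`, and they belong to the
orthogonal system of exponentials on `[0, M * 2π/κ]`. -/
theorem exists_tsum_enorm_integral_mul_exp_le {κ τ : ℝ} (hκ : 0 < κ) (hτ : 0 < τ) :
    ∃ C : ℝ≥0∞, C ≠ ⊤ ∧ ∀ k : ℝ → ℂ, MemLp k 2 (volume.restrict (Icc 0 τ)) →
      ∑' n : ℤ, ‖∫ t in (0 : ℝ)..τ, k t * exp (I * n * κ * t)‖ₑ ^ 2 ≤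
        C * ∫⁻ t in Icc 0 τ, ‖k t‖ₑ ^ 2 := by
  obtain ⟨M, hM⟩ := exists_nat_gt (τ * κ / (2 * Real.pi))
  have hpi := Real.pi_pos
  have hM0 : 0 < (M : ℝ) := lt_trans (by positivity) hM
  set b : ℝ := M * (2 * Real.pi / κ) with hb
  have hb0 : 0 < b := by positivity
  have hτb : τ ≤ b := by
    rw [div_lt_iff₀ (by positivity)] at hM
    rw [hb, mul_div_assoc', le_div_iff₀ hκ]
    exact hM.le
  refine ⟨ENNReal.ofReal (b ^ 2 * (b - 0)⁻¹), ENNReal.ofReal_ne_top, fun k hk => ?_⟩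
  set f : ℝ → ℂ := (Ioc 0 τ).indicator k with hf
  have hk' : MemLp k 2 (volume.restrict (Ioc 0 τ)) := by
    rwa [restrict_Ioc_eq_restrict_Icc]
  have hfL : MemLp f 2 (volume.restrict (Ioc 0 b)) := by
    rw [hf]
    exact ((memLp_indicator_iff_restrict measurableSet_Ioc).2 hk').restrict _
  have hs := hasSum_sq_fourierCoeffOn hb0 hfL
  have hc : ∀ n : ℤ, ‖∫ t in (0 : ℝ)..τ, k t * exp (I * n * κ * t)‖ₑ ^ 2 =
      ENNReal.ofReal (b ^ 2) * ENNReal.ofReal (‖fourierCoeffOn hb0 f (-(M * n))‖ ^ 2) := by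
    intro n
    rw [fourierCoeffOn_eq_integral, enorm_sq_eq_ofReal, ← ENNReal.ofReal_mul (by positivity)]
    congr 1
    rw [norm_smul, mul_pow ‖1 / (b - 0)‖, ← mul_assoc]
    have : b ^ 2 * ‖1 / (b - 0)‖ ^ 2 = 1 := by
      rw [sub_zero, Real.norm_of_nonneg (by positivity)]; field_simp
    rw [this, one_mul]
    congr 2
    have h1 : ∀ x : ℝ, fourier (- -((M : ℤ) * n)) (x : AddCircle (b - 0)) • f x =
        (Ioc 0 τ).indicator (fun t => k t * exp (I * n * κ * t)) x := by
      intro x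
      by_cases hx : x ∈ Ioc 0 τ
      · rw [hf, indicator_of_mem hx, indicator_of_mem hx, fourier_coe_apply, smul_eq_mul, mul_comm]
        congr 2
        rw [sub_zero, hb]
        push_cast
        have hκc : (κ : ℂ) ≠ 0 := ofReal_ne_zero.2 hκ.ne'
        have hMc : (M : ℂ) ≠ 0 := by exact_mod_cast hM0.ne'
        have hpc : (Real.pi : ℂ) ≠ 0 := ofReal_ne_zero.2 hpi.ne'
        field_simp
      · rw [hf, indicator_of_notMem hx, indicator_of_notMem hx, smul_zero]
    simp_rw [h1]
    rw [intervalIntegral.integral_of_le hτ.le, intervalIntegral.integral_of_le hb0.le,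
      setIntegral_indicator measurableSet_Ioc, inter_eq_right.2 (Ioc_subset_Ioc_right hτb)]
  simp_rw [hc]
  rw [ENNReal.tsum_mul_left, ENNReal.ofReal_mul (by positivity), mul_assoc]
  gcongr
  have hinj : Function.Injective fun n : ℤ => -((M : ℤ) * n) := by
    intro m n h
    have hMz : (M : ℤ) ≠ 0 := by exact_mod_cast hM0.ne'
    exact mul_left_cancel₀ hMz (neg_injective h)
  refine (ENNReal.tsum_comp_le_tsum_of_injective hinj
    fun m => ENNReal.ofReal (‖fourierCoeffOn hb0 f m‖ ^ 2)).trans ?_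
  rw [← ENNReal.ofReal_tsum_of_nonneg (fun _ => sq_nonneg _) hs.summable, hs.tsum_eq, smul_eq_mul,
    ENNReal.ofReal_mul (by rw [sub_zero]; positivity), intervalIntegral.integral_of_le hb0.le,
    ← lintegral_enorm_sq_eq hfL]
  refine mul_le_mul' le_rfl ?_
  have h2 : ∀ x, ‖f x‖ₑ ^ 2 = (Ioc 0 τ).indicator (fun t => ‖k t‖ₑ ^ 2) x := by
    intro x
    by_cases hx : x ∈ Ioc 0 τ
    · rw [hf, indicator_of_mem hx, indicator_of_mem hx]
    · rw [hf, indicator_of_notMem hx, indicator_of_notMem hx]; simp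
  simp_rw [h2]
  rw [setLIntegral_indicator measurableSet_Ioc, inter_eq_left.2 (Ioc_subset_Ioc_right hτb)]
  exact lintegral_mono_set Ioc_subset_Icc_self

/-! ### Cosine coefficients of the derivative of a test function -/

theorem Test.contDiff_deriv (φ : Test) : ContDiff ℝ ∞ (deriv (φ : ℝ → ℂ)) :=
  (contDiff_infty_iff_deriv.1 φ.contDiff).2

theorem Test.enorm_sq (φ : Test) :
    ‖φ‖ₑ ^ 2 = ∫⁻ x in Icc 0 Real.pi, ‖deriv (φ : ℝ → ℂ) x‖ₑ ^ 2 :=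
  enorm_toLp_sq φ.memLp_deriv

theorem Test.norm_le_of_forall {φ : Test} {M : ℝ} (hM : 0 ≤ M)
    (h : ∀ x ∈ Ico 0 Real.pi, ‖deriv (φ : ℝ → ℂ) x‖ ≤ M) : ‖φ‖ ≤ Real.sqrt Real.pi * M := by
  have h1 : ‖φ‖ₑ ^ 2 ≤ ENNReal.ofReal ((Real.sqrt Real.pi * M) ^ 2) := by
    rw [φ.enorm_sq, ← restrict_Ico_eq_restrict_Icc]
    calc _ ≤ ∫⁻ x in Ico 0 Real.pi, ENNReal.ofReal (M ^ 2) := by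
          refine setLIntegral_mono measurable_const fun x hx => ?_
          rw [enorm_sq_eq_ofReal]
          have := h x hx
          gcongr
      _ = _ := by
          rw [setLIntegral_const, Real.volume_Ico, ← ENNReal.ofReal_mul (by positivity), mul_pow,
            Real.sq_sqrt Real.pi_pos.le, sub_zero, mul_comm]
  rw [enorm_sq_eq_ofReal, ENNReal.ofReal_le_ofReal_iff (by positivity)] at h1
  exact (abs_le_of_sq_le_sq' h1 (by positivity)).2

theorem norm_integral_cos_mul_le (n : ℤ) (φ : Test) :
    ‖∫ x in (0 : ℝ)..Real.pi, cos (n * x) * deriv (φ : ℝ → ℂ) x‖ ≤ Real.sqrt Real.pi * ‖φ‖ := by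
  have hc : Continuous fun x : ℝ => cos ((n : ℂ) * x) := by fun_prop
  have hb : ∀ x : ℝ, ‖cos ((n : ℂ) * x)‖ ≤ 1 := fun x => by
    rw [← ofReal_intCast, ← ofReal_mul, ← ofReal_cos, norm_real]
    exact Real.abs_cos_le_one _
  have hcL : MemLp (fun x : ℝ => cos ((n : ℂ) * x)) 2 (volume.restrict (Icc 0 Real.pi)) :=
    MemLp.of_bound hc.aestronglyMeasurable 1 (Filter.Eventually.of_forall hb)
  have h1 : ∫ x in (0 : ℝ)..Real.pi, cos (n * x) * deriv (φ : ℝ → ℂ) x =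
      inner ℂ (hcL.toLp _) (Test.derivL2 φ) := by
    rw [L2.inner_def, intervalIntegral.integral_of_le Real.pi_pos.le,
      integral_Ioc_eq_integral_Ioo, ← integral_Icc_eq_integral_Ioo]
    refine integral_congr_ae ?_
    filter_upwards [hcL.coeFn_toLp, φ.memLp_deriv.coeFn_toLp] with x h1 h2
    have h3 : (Test.derivL2 φ) x = deriv (φ : ℝ → ℂ) x := h2
    rw [h1, h3, RCLike.inner_apply, ← ofReal_intCast, ← ofReal_mul, ← ofReal_cos, conj_ofReal,
      mul_comm]
  rw [h1]
  refine (norm_inner_le_norm _ _).trans ?_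
  have h2 : ‖hcL.toLp _‖ ≤ Real.sqrt Real.pi := by
    refine (Lp.norm_le_of_ae_bound zero_le_one ?_).trans (le_of_eq ?_)
    · filter_upwards [hcL.coeFn_toLp] with x h1
      rw [h1]; exact hb x
    · simp [measureUnivNNReal, Real.sqrt_eq_rpow, ENNReal.coe_toNNReal_eq_toReal, Real.pi_pos.le]
  exact mul_le_mul_of_nonneg_right h2 (norm_nonneg _)

theorem Test.intervalIntegrable_mul_deriv (φ : Test) {f : ℝ → ℂ} (hf : Continuous f) (a b : ℝ) :
    IntervalIntegrable (fun x => f x * deriv (φ : ℝ → ℂ) x) volume a b :=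
  (hf.mul φ.contDiff_deriv.continuous).intervalIntegrable _ _

/-- The functional `φ ↦ ∫₀^π cos(nx) φ'(x) dx` on test functions. -/
def cosCoeff (n : ℤ) : WNeg :=
  LinearMap.mkContinuous
    { toFun := fun φ => ∫ x in (0 : ℝ)..Real.pi, cos (n * x) * deriv (φ : ℝ → ℂ) x
      map_add' := fun φ ψ => by
        rw [← intervalIntegral.integral_add (φ.intervalIntegrable_mul_deriv (by fun_prop) _ _)
          (ψ.intervalIntegrable_mul_deriv (by fun_prop) _ _)]
        congr 1
        funext x
        rw [← mul_add]
        congr 1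
        exact deriv_add (φ.differentiable x) (ψ.differentiable x)
      map_smul' := fun c φ => by
        rw [RingHom.id_apply, smul_eq_mul, ← intervalIntegral.integral_const_mul]
        congr 1
        funext x
        rw [mul_left_comm]
        congr 1
        exact deriv_const_smul c (φ.differentiable x) }
    (Real.sqrt Real.pi) (norm_integral_cos_mul_le n)

theorem cosCoeff_apply (n : ℤ) (φ : Test) :
    cosCoeff n φ = ∫ x in (0 : ℝ)..Real.pi, cos (n * x) * deriv (φ : ℝ → ℂ) x := rfl

theorem norm_cosCoeff_le (n : ℤ) : ‖cosCoeff n‖ ≤ Real.sqrt Real.pi :=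
  LinearMap.mkContinuous_norm_le _ (Real.sqrt_nonneg _) _

theorem exists_tsum_sq_cosCoeff_le : ∃ B : ℝ, 0 ≤ B ∧ ∀ φ : Test,
    (Summable fun n => ‖cosCoeff n φ‖ ^ 2) ∧ ∑' n, ‖cosCoeff n φ‖ ^ 2 ≤ B * ‖φ‖ ^ 2 := by
  obtain ⟨C, hC, h⟩ := exists_tsum_enorm_integral_mul_exp_le one_pos Real.pi_pos
  refine ⟨C.toReal, ENNReal.toReal_nonneg, fun φ => ?_⟩
  have h1 := h _ φ.memLp_deriv
  rw [← φ.enorm_sq] at h1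
  set e : ℤ → ℂ := fun n =>
    ∫ t in (0 : ℝ)..Real.pi, deriv (φ : ℝ → ℂ) t * exp (I * n * (1 : ℝ) * t) with he
  have h2 : ∀ n, cosCoeff n φ = (e n + e (-n)) / 2 := by
    intro n
    rw [he, cosCoeff_apply]
    dsimp only
    rw [← intervalIntegral.integral_add, ← intervalIntegral.integral_div]
    · congr 1
      funext x
      rw [Complex.cos]
      push_cast
      rw [show I * n * 1 * x = n * x * I by ring, show I * -n * 1 * x = -(n * x) * I by ring]
      ring
    · exact (φ.contDiff_deriv.continuous.mul (by fun_prop)).intervalIntegrable _ _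
    · exact (φ.contDiff_deriv.continuous.mul (by fun_prop)).intervalIntegrable _ _
  have hfin : C * ‖φ‖ₑ ^ 2 ≠ ⊤ := ENNReal.mul_ne_top hC (by simp)
  have he2 : ∑' n, ENNReal.ofReal (‖e n‖ ^ 2) ≤ C * ‖φ‖ₑ ^ 2 := by
    simp_rw [← enorm_sq_eq_ofReal]; exact h1
  have hes : Summable fun n => ‖e n‖ ^ 2 := by
    have := ENNReal.summable_toReal (ne_top_of_le_ne_top hfin he2)
    simpa [ENNReal.toReal_ofReal] using this
  have hes' : Summable fun n => ‖e (-n)‖ ^ 2 := (Equiv.neg ℤ).summable_iff.2 hes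
  have hle : ∀ n, ‖cosCoeff n φ‖ ^ 2 ≤ (‖e n‖ ^ 2 + ‖e (-n)‖ ^ 2) / 2 := by
    intro n
    rw [h2, norm_div, div_pow, Complex.norm_two]
    have : ‖e n + e (-n)‖ ^ 2 ≤ (‖e n‖ + ‖e (-n)‖) ^ 2 := by gcongr; exact norm_add_le _ _
    nlinarith [sq_nonneg (‖e n‖ - ‖e (-n)‖)]
  have hsum := ((hes.add hes').div_const 2)
  have hcs : Summable fun n => ‖cosCoeff n φ‖ ^ 2 :=
    Summable.of_nonneg_of_le (fun _ => sq_nonneg _) hle hsum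
  have htn : ∑' n, ‖e (-n)‖ ^ 2 = ∑' n, ‖e n‖ ^ 2 := (Equiv.neg ℤ).tsum_eq fun n => ‖e n‖ ^ 2
  refine ⟨hcs, (hcs.tsum_le_tsum hle hsum).trans ?_⟩
  rw [tsum_div_const, hes.tsum_add hes', htn, add_self_div_two]
  rw [← ENNReal.ofReal_tsum_of_nonneg (fun _ => sq_nonneg _) hes] at he2
  have := ENNReal.toReal_mono hfin he2
  rw [ENNReal.toReal_ofReal (tsum_nonneg fun _ => sq_nonneg _), ENNReal.toReal_mul,
    ENNReal.toReal_pow, toReal_enorm] at this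
  exact this

theorem hasDerivAt_cos_int_mul (n : ℤ) (x : ℝ) :
    HasDerivAt (fun x : ℝ => cos ((n : ℂ) * x)) (-(n * sin (n * x))) x := by
  have h := (((hasDerivAt_id (x : ℂ)).const_mul (n : ℂ)).ccos).comp_ofReal
  convert! h using 1
  simp only [id_eq, mul_one]; ring

theorem hasDerivAt_sin_int_mul (n : ℤ) (x : ℝ) :
    HasDerivAt (fun x : ℝ => sin ((n : ℂ) * x)) (n * cos (n * x)) x := by
  have h := (((hasDerivAt_id (x : ℂ)).const_mul (n : ℂ)).csin).comp_ofReal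
  convert! h using 1
  simp only [id_eq, mul_one]; ring

theorem integral_cos_mul_deriv (n : ℤ) {f : ℝ → ℂ} (hf : ContDiff ℝ ∞ f) :
    ∫ x in (0 : ℝ)..Real.pi, cos (n * x) * deriv f x =
      cos (n * Real.pi) * f Real.pi - f 0 + n * ∫ x in (0 : ℝ)..Real.pi, sin (n * x) * f x := by
  rw [intervalIntegral.integral_mul_deriv_eq_deriv_mul (fun x _ => hasDerivAt_cos_int_mul n x)
    (fun x _ => ((hf.differentiable (by simp)) x).hasDerivAt)
    (Continuous.intervalIntegrable (by fun_prop) _ _)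
    ((contDiff_infty_iff_deriv.1 hf).2.continuous.intervalIntegrable _ _),
    ← intervalIntegral.integral_const_mul]
  simp only [ofReal_zero, mul_zero, Complex.cos_zero, one_mul, neg_mul,
    intervalIntegral.integral_neg, sub_neg_eq_add, mul_assoc]

theorem integral_sin_mul_deriv (n : ℤ) {f : ℝ → ℂ} (hf : ContDiff ℝ ∞ f) :
    ∫ x in (0 : ℝ)..Real.pi, sin (n * x) * deriv f x =
      -(n * ∫ x in (0 : ℝ)..Real.pi, cos (n * x) * f x) := by
  rw [intervalIntegral.integral_mul_deriv_eq_deriv_mul (fun x _ => hasDerivAt_sin_int_mul n x)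
    (fun x _ => ((hf.differentiable (by simp)) x).hasDerivAt)
    (Continuous.intervalIntegrable (by fun_prop) _ _)
    ((contDiff_infty_iff_deriv.1 hf).2.continuous.intervalIntegrable _ _),
    ← intervalIntegral.integral_const_mul]
  have : sin ((n : ℂ) * Real.pi) = 0 := Complex.sin_int_mul_pi n
  simp only [this, ofReal_zero, mul_zero, Complex.sin_zero, zero_mul, sub_zero, zero_sub, mul_assoc]

theorem cosCoeff_eq_sin (n : ℤ) (φ : Test) :
    cosCoeff n φ = n * ∫ x in (0 : ℝ)..Real.pi, sin (n * x) * φ x := by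
  rw [cosCoeff_apply, integral_cos_mul_deriv n φ.contDiff]
  have h0 : φ 0 = 0 := φ.2.2.1
  have h1 : φ Real.pi = 0 := φ.2.2.2
  rw [h0, h1]; ring

theorem cosCoeff_deriv_deriv {φ ψ : Test} (h : ∀ x, ψ x = deriv (deriv φ) x) (n : ℤ) :
    cosCoeff n ψ = -(n : ℂ) ^ 2 * cosCoeff n φ := by
  rw [cosCoeff_eq_sin]
  simp_rw [h]
  rw [integral_sin_mul_deriv n φ.contDiff_deriv, ← cosCoeff_apply]
  ring

theorem cosCoeff_zero (φ : Test) : cosCoeff 0 φ = 0 := by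
  rw [cosCoeff_eq_sin]; simp

theorem cosCoeff_neg (n : ℤ) : cosCoeff (-n) = cosCoeff n := by
  ext φ
  simp [cosCoeff_apply]

/-- Two integrations by parts give `n² Cₙφ = O(1)`; the boundary terms at the last step need not
vanish. -/
theorem summable_norm_cosCoeff (φ : Test) : Summable fun n => ‖cosCoeff n φ‖ := by
  set f := deriv (deriv (φ : ℝ → ℂ)) with hf
  have hfs : ContDiff ℝ ∞ f := (contDiff_infty_iff_deriv.1 φ.contDiff_deriv).2
  set K := ‖f Real.pi‖ + ‖f 0‖ + ∫ x in (0 : ℝ)..Real.pi, ‖deriv f x‖ with hK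
  have hb : ∀ (n : ℤ) (x : ℝ), ‖cos ((n : ℂ) * x)‖ ≤ 1 := fun n x => by
    rw [← ofReal_intCast, ← ofReal_mul, ← ofReal_cos, norm_real]
    exact Real.abs_cos_le_one _
  have hs : Summable fun n : ℤ => K * (1 / (n : ℝ) ^ 2) :=
    (Real.summable_one_div_int_pow.2 one_lt_two).mul_left K
  refine Summable.of_nonneg_of_le (fun _ => norm_nonneg _) (fun n => ?_) hs
  rcases eq_or_ne n 0 with rfl | hn
  · rw [cosCoeff_zero]; simp
  · have hn' : (n : ℂ) ≠ 0 := by exact_mod_cast hn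
    have h1 := integral_sin_mul_deriv n φ.contDiff_deriv
    rw [← cosCoeff_apply, ← hf] at h1
    have h2 := integral_cos_mul_deriv n hfs
    rw [h1] at h2
    have h3 : (n : ℂ) ^ 2 * cosCoeff n φ = cos (n * Real.pi) * f Real.pi - f 0 -
        ∫ x in (0 : ℝ)..Real.pi, cos (n * x) * deriv f x := by rw [h2]; ring
    have h4 : (n : ℝ) ^ 2 * ‖cosCoeff n φ‖ ≤ K := by
      have : (n : ℝ) ^ 2 * ‖cosCoeff n φ‖ = ‖(n : ℂ) ^ 2 * cosCoeff n φ‖ := by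
        rw [norm_mul, norm_pow, Complex.norm_intCast, sq_abs]
      rw [this, h3, hK]
      refine (norm_sub_le _ _).trans (add_le_add ((norm_sub_le _ _).trans (add_le_add ?_ le_rfl)) ?_)
      · rw [norm_mul]
        exact mul_le_of_le_one_left (norm_nonneg _) (hb n _)
      · refine (intervalIntegral.norm_integral_le_integral_norm Real.pi_pos.le).trans ?_
        have hc := (contDiff_infty_iff_deriv.1 hfs).2.continuous
        refine intervalIntegral.integral_mono_on Real.pi_pos.le
          (Continuous.intervalIntegrable (by fun_prop) _ _)
          (Continuous.intervalIntegrable (by fun_prop) _ _) fun x _ => ?_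
        rw [norm_mul]
        exact mul_le_of_le_one_left (norm_nonneg _) (hb n _)
    have hn2 : (0 : ℝ) < (n : ℝ) ^ 2 := by positivity
    rw [mul_one_div, le_div_iff₀ hn2, mul_comm]
    exact h4

/-- The cosine series of `φ'` converges to `φ'`, as the even `2π`-periodic extension of `φ'` is
continuous with summable Fourier coefficients. -/
theorem hasSum_cosCoeff_mul_cos (φ : Test) {x : ℝ} (hx : x ∈ Ico 0 Real.pi) :
    HasSum (fun n : ℤ => 1 / (Real.pi : ℂ) * cosCoeff n φ * cos (n * x))
      (deriv (φ : ℝ → ℂ) x) := by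
  have hpi := Real.pi_pos
  have : Fact (0 < 2 * Real.pi) := ⟨by positivity⟩
  set F : ℝ → ℂ := fun y => deriv (φ : ℝ → ℂ) |y| with hF
  have hFc : Continuous F := φ.contDiff_deriv.continuous.comp continuous_abs
  have hend : F (-Real.pi) = F (-Real.pi + 2 * Real.pi) := by
    rw [hF]; dsimp only; rw [abs_neg]; congr 2; ring
  let G : C(AddCircle (2 * Real.pi), ℂ) :=
    ⟨AddCircle.liftIco (2 * Real.pi) (-Real.pi) F,
      AddCircle.liftIco_continuous hend hFc.continuousOn⟩
  have hcoeff : ∀ n, fourierCoeff G n = 1 / (Real.pi : ℂ) * cosCoeff n φ := by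
    intro n
    have h1 : fourierCoeff G n = _ := fourierCoeff_liftIco_eq (T := 2 * Real.pi) (a := -Real.pi) F n
    rw [h1, fourierCoeffOn_eq_integral]
    have hper : -Real.pi + 2 * Real.pi - -Real.pi = 2 * Real.pi := by ring
    have h2 : ∀ y : ℝ, fourier (-n) (y : AddCircle (-Real.pi + 2 * Real.pi - -Real.pi)) • F y =
        exp (-(n * y) * I) * F y := by
      intro y
      rw [fourier_coe_apply, smul_eq_mul, hper]
      congr 2
      push_cast
      have hpc : (Real.pi : ℂ) ≠ 0 := ofReal_ne_zero.2 hpi.ne'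
      field_simp
    simp_rw [h2]
    have hcont : Continuous fun y : ℝ => exp (-((n : ℂ) * y) * I) * F y := by fun_prop
    rw [show -Real.pi + 2 * Real.pi = Real.pi by ring,
      ← intervalIntegral.integral_add_adjacent_intervals (b := 0)
        (hcont.intervalIntegrable _ _) (hcont.intervalIntegrable _ _)]
    have h3 : ∫ y in (-Real.pi)..0, exp (-((n : ℂ) * y) * I) * F y =
        ∫ y in (0 : ℝ)..Real.pi, exp ((n : ℂ) * y * I) * F y := by
      have := intervalIntegral.integral_comp_neg (a := 0) (b := Real.pi)
        (fun y : ℝ => exp (-((n : ℂ) * y) * I) * F y)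
      rw [neg_zero] at this
      rw [← this]
      congr 1
      funext y
      rw [hF]; dsimp only; rw [abs_neg]; push_cast
      congr 2; ring
    rw [h3, ← intervalIntegral.integral_add
      (Continuous.intervalIntegrable (by fun_prop) _ _) (hcont.intervalIntegrable _ _),
      cosCoeff_apply]
    have h4 : ∫ y in (0 : ℝ)..Real.pi, (exp ((n : ℂ) * y * I) * F y + exp (-((n : ℂ) * y) * I) * F y)
        = ∫ y in (0 : ℝ)..Real.pi, 2 * (cos (n * y) * deriv (φ : ℝ → ℂ) y) := by
      refine intervalIntegral.integral_congr fun y hy => ?_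
      rw [uIcc_of_le hpi.le] at hy
      rw [hF]; dsimp only
      rw [abs_of_nonneg hy.1, Complex.cos]; ring
    rw [h4, intervalIntegral.integral_const_mul, Complex.real_smul]
    push_cast
    have hpc : (Real.pi : ℂ) ≠ 0 := ofReal_ne_zero.2 hpi.ne'
    field_simp
    ring
  have hsum : Summable (fourierCoeff G) := by
    rw [show fourierCoeff G = fun n => 1 / (Real.pi : ℂ) * cosCoeff n φ from funext hcoeff]
    exact (summable_norm_cosCoeff φ).of_norm.mul_left _
  have h := has_pointwise_sum_fourier_series_of_summable hsum (x : AddCircle (2 * Real.pi))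
  have hGx : G (x : AddCircle (2 * Real.pi)) = deriv (φ : ℝ → ℂ) x := by
    have hxm : x ∈ Ico (-Real.pi) (-Real.pi + 2 * Real.pi) :=
      ⟨by linarith [hx.1], by linarith [hx.2]⟩
    have : G (x : AddCircle (2 * Real.pi)) = F x := by
      change AddCircle.liftIco (2 * Real.pi) (-Real.pi) F x = F x
      exact AddCircle.liftIco_coe_apply hxm
    rw [this, hF]; dsimp only; rw [abs_of_nonneg hx.1]
  rw [hGx] at h
  have h' := (h.add ((Equiv.neg ℤ).hasSum_iff.2 h)).div_const 2
  rw [add_self_div_two] at h'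
  convert! h' using 1
  funext n
  simp only [Function.comp_apply, Equiv.neg_apply, hcoeff, smul_eq_mul, fourier_coe_apply,
    cosCoeff_neg]
  rw [Complex.cos]
  have hpc : (Real.pi : ℂ) ≠ 0 := ofReal_ne_zero.2 hpi.ne'
  rw [show 2 * (Real.pi : ℂ) * I * n * x / ((2 * Real.pi : ℝ) : ℂ) = n * x * I by
      push_cast; field_simp,
    show 2 * (Real.pi : ℂ) * I * ((-n : ℤ) : ℂ) * x / ((2 * Real.pi : ℝ) : ℂ) = -(n * x) * I by
      push_cast; field_simp]
  ring

/-! ### The boundary flux of the heat semigroup -/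

theorem exists_exp_neg_sq_mul_le {β : ℝ} (hβ : 0 < β) (τ : ℝ) :
    ∃ C : ℝ, 0 ≤ C ∧ ∀ r ∈ Ioc 0 τ, ∀ n : ℤ,
      Real.exp (-(n : ℝ) ^ 2 * r) ≤ C * r ^ (-β) * (max 1 |(n : ℝ)|) ^ (-(2 * β)) := by
  refine ⟨max (β ^ β) (τ ^ β), by positivity, fun r hr n => ?_⟩
  have hr0 : 0 < r := hr.1
  rcases eq_or_ne n 0 with rfl | hn
  · have h1 : (1 : ℝ) ≤ τ ^ β * r ^ (-β) := by
      rw [Real.rpow_neg hr0.le, ← div_eq_mul_inv, one_le_div (by positivity)]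
      exact Real.rpow_le_rpow hr0.le hr.2 hβ.le
    simp only [Int.cast_zero, abs_zero, ne_eq, OfNat.ofNat_ne_zero, not_false_eq_true, zero_pow,
      neg_zero, zero_mul, Real.exp_zero, zero_le_one, sup_of_le_left, Real.one_rpow, mul_one]
    exact h1.trans (by gcongr; exact le_max_right _ _)
  · have h1 : (1 : ℝ) ≤ |(n : ℝ)| := by exact_mod_cast Int.one_le_abs hn
    have hn0 : 0 < |(n : ℝ)| := by linarith
    rw [max_eq_right h1, neg_mul, ← sq_abs]
    refine (exp_neg_le_rpow hβ (by positivity)).trans ?_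
    rw [Real.mul_rpow (by positivity) hr0.le, ← Real.rpow_natCast, ← Real.rpow_mul hn0.le,
      show ((2 : ℕ) : ℝ) * -β = -(2 * β) by push_cast; ring, mul_comm (|(n : ℝ)| ^ _), ← mul_assoc]
    gcongr
    exact le_max_left _ _

theorem summable_exp_neg_sq_mul {r : ℝ} (hr : 0 < r) :
    Summable fun n : ℤ => Real.exp (-(n : ℝ) ^ 2 * r) := by
  obtain ⟨C, _, h⟩ := exists_exp_neg_sq_mul_le one_pos r
  exact Summable.of_nonneg_of_le (fun _ => (Real.exp_pos _).le) (h r ⟨hr, le_rfl⟩)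
    ((summable_max_one_abs_rpow (by norm_num)).mul_left _)

theorem summable_abs_mul_exp_neg_sq_mul {r : ℝ} (hr : 0 < r) :
    Summable fun n : ℤ => |(n : ℝ)| * Real.exp (-(n : ℝ) ^ 2 * r) := by
  obtain ⟨C, hC, h⟩ := exists_exp_neg_sq_mul_le (β := 3 / 2) (by norm_num) r
  refine Summable.of_nonneg_of_le (fun _ => by positivity) (fun n => ?_)
    ((summable_max_one_abs_rpow (b := 2) (by norm_num)).mul_left (C * r ^ (-(3 / 2 : ℝ))))
  have h1 := h r ⟨hr, le_rfl⟩ n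
  have hm : 0 < max 1 |(n : ℝ)| := lt_of_lt_of_le one_pos (le_max_left _ _)
  have h2 : (max 1 |(n : ℝ)|) ^ (-2 : ℝ) =
      max 1 |(n : ℝ)| * (max 1 |(n : ℝ)|) ^ (-(2 * (3 / 2 : ℝ))) := by
    nth_rw 2 [← Real.rpow_one (max 1 |(n : ℝ)|)]
    rw [← Real.rpow_add hm]; norm_num
  rw [h2]
  calc _ ≤ max 1 |(n : ℝ)| * (C * r ^ (-(3 / 2 : ℝ)) * (max 1 |(n : ℝ)|) ^ (-(2 * (3 / 2 : ℝ)))) := by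
        gcongr; exact le_max_right _ _
    _ = _ := by ring

/-- The operator norm on functionals separates points although `Test` is only seminormed. -/
instance : NormedAddCommGroup WNeg :=
  NormedAddCommGroup.ofSeparation fun f hf => ContinuousLinearMap.ext fun φ =>
    norm_le_zero_iff.1 <| (f.le_opNorm φ).trans_eq (by rw [hf, zero_mul])

/-- The functional `φ ↦ ∂ₓ(S(r)φ)(0)`, with `S` the Dirichlet heat semigroup on `(0, π)`, for
`r > 0`. -/
def boundaryFlux (r : ℝ) : WNeg :=
  (1 / (Real.pi : ℂ)) • ∑' n : ℤ, (Real.exp (-(n : ℝ) ^ 2 * r) : ℂ) • cosCoeff n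

theorem norm_exp_smul_cosCoeff_le (r : ℝ) (n : ℤ) :
    ‖(Real.exp (-(n : ℝ) ^ 2 * r) : ℂ) • cosCoeff n‖ ≤
      Real.sqrt Real.pi * Real.exp (-(n : ℝ) ^ 2 * r) := by
  rw [norm_smul, norm_real, Real.norm_of_nonneg (Real.exp_pos _).le, mul_comm]
  exact mul_le_mul_of_nonneg_right (norm_cosCoeff_le n) (Real.exp_pos _).le

theorem hasSum_boundaryFlux {r : ℝ} (hr : 0 < r) (φ : Test) :
    HasSum (fun n : ℤ => 1 / (Real.pi : ℂ) * ((Real.exp (-(n : ℝ) ^ 2 * r) : ℂ) * cosCoeff n φ))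
      (boundaryFlux r φ) := by
  have h : Summable fun n : ℤ => (Real.exp (-(n : ℝ) ^ 2 * r) : ℂ) • cosCoeff n :=
    Summable.of_norm_bounded ((summable_exp_neg_sq_mul hr).mul_left _)
      (norm_exp_smul_cosCoeff_le r)
  have h2 := (ContinuousLinearMap.apply ℂ ℂ φ).hasSum h.hasSum
  exact h2.mul_left (1 / (Real.pi : ℂ))

theorem continuousOn_boundaryFlux : ContinuousOn boundaryFlux (Ioi 0) := by
  intro r hr
  have hr0 : (0 : ℝ) < r := hr
  refine ContinuousAt.continuousWithinAt ?_
  have hu := (summable_exp_neg_sq_mul (half_pos hr0)).mul_left (Real.sqrt Real.pi)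
  have h : ContinuousOn (fun r : ℝ => ∑' n : ℤ, (Real.exp (-(n : ℝ) ^ 2 * r) : ℂ) • cosCoeff n)
      (Ioi (r / 2)) := by
    refine continuousOn_tsum (fun n => ?_) hu fun n x hx => ?_
    · have hc : Continuous fun x : ℝ => (Real.exp (-(n : ℝ) ^ 2 * x) : ℂ) := by fun_prop
      exact (hc.smul continuous_const).continuousOn
    · refine (norm_exp_smul_cosCoeff_le x n).trans ?_
      have hx' : r / 2 < x := hx
      gcongr 2
      nlinarith [sq_nonneg (n : ℝ)]
  exact (h.continuousAt (Ioi_mem_nhds (half_lt_self hr0))).const_smul (1 / (Real.pi : ℂ))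

/-- The norm of the flux in `W^{-1,2}` blows up slightly faster than `r^{-1/4}` at most. Summing the
norms of the terms would give no exponent better than `1/2`; Bessel's inequality halves it. -/
theorem exists_norm_boundaryFlux_le {β : ℝ} (hβ : 1 / 2 < β) (τ : ℝ) :
    ∃ C : ℝ, 0 ≤ C ∧ ∀ r ∈ Ioc 0 τ, ‖boundaryFlux r‖ ≤ C * r ^ (-(β / 2)) := by
  obtain ⟨B, hB, hcs⟩ := exists_tsum_sq_cosCoeff_le
  obtain ⟨D, hD, hexp⟩ := exists_exp_neg_sq_mul_le (β := β) (by linarith) τ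
  set S := ∑' n : ℤ, (max 1 |(n : ℝ)|) ^ (-(2 * β)) with hS
  have hSs := summable_max_one_abs_rpow (b := 2 * β) (by linarith)
  have hS0 : 0 ≤ S := tsum_nonneg fun n => by positivity
  refine ⟨1 / Real.pi * (Real.sqrt (D * S) * Real.sqrt B), by positivity, fun r hr => ?_⟩
  have hr0 : 0 < r := hr.1
  have hpi := Real.pi_pos
  refine ContinuousLinearMap.opNorm_le_bound _ (by positivity) fun φ => ?_
  obtain ⟨hs, hle⟩ := hcs φ
  have hsq : ∀ n : ℤ, Real.exp (-(n : ℝ) ^ 2 * r) ^ (2 : ℝ) ≤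
      D * r ^ (-β) * (max 1 |(n : ℝ)|) ^ (-(2 * β)) := by
    intro n
    refine le_trans ?_ (hexp r hr n)
    have h1 : Real.exp (-(n : ℝ) ^ 2 * r) ≤ 1 := by
      rw [Real.exp_le_one_iff]; nlinarith [sq_nonneg (n : ℝ)]
    rw [Real.rpow_two, sq]
    exact mul_le_of_le_one_left (Real.exp_pos _).le h1
  have hsum1 : Summable fun n : ℤ => Real.exp (-(n : ℝ) ^ 2 * r) ^ (2 : ℝ) :=
    Summable.of_nonneg_of_le (fun _ => by positivity) hsq (hSs.mul_left _)
  have hs' : Summable fun n => ‖cosCoeff n φ‖ ^ (2 : ℝ) := by simpa using hs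
  have hCS := Real.inner_le_Lp_mul_Lq_tsum_of_nonneg Real.HolderConjugate.two_two
    (f := fun n : ℤ => Real.exp (-(n : ℝ) ^ 2 * r)) (g := fun n => ‖cosCoeff n φ‖)
    (fun _ => (Real.exp_pos _).le) (fun _ => norm_nonneg _) hsum1 hs'
  have hCS' := Real.summable_mul_of_Lp_Lq_of_nonneg Real.HolderConjugate.two_two
    (f := fun n : ℤ => Real.exp (-(n : ℝ) ^ 2 * r)) (g := fun n => ‖cosCoeff n φ‖)
    (fun _ => (Real.exp_pos _).le) (fun _ => norm_nonneg _) hsum1 hs'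
  have hT1 : ∑' n : ℤ, Real.exp (-(n : ℝ) ^ 2 * r) ^ (2 : ℝ) ≤ D * S * r ^ (-β) := by
    refine (hsum1.tsum_le_tsum hsq (hSs.mul_left _)).trans (le_of_eq ?_)
    rw [tsum_mul_left, ← hS]; ring
  have hT2 : ∑' n, ‖cosCoeff n φ‖ ^ (2 : ℝ) ≤ B * ‖φ‖ ^ 2 := by simpa using hle
  have hn : ‖boundaryFlux r φ‖ ≤ 1 / Real.pi *
      ∑' n : ℤ, Real.exp (-(n : ℝ) ^ 2 * r) * ‖cosCoeff n φ‖ := by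
    rw [← (hasSum_boundaryFlux hr0 φ).tsum_eq]
    refine tsum_of_norm_bounded (hCS'.hasSum.mul_left _) fun n => le_of_eq ?_
    rw [norm_mul, norm_mul, norm_real, Real.norm_of_nonneg (Real.exp_pos _).le, norm_div, norm_one,
      norm_real, Real.norm_of_nonneg hpi.le]
  refine hn.trans ?_
  rw [mul_assoc, mul_assoc (1 / Real.pi)]
  refine mul_le_mul_of_nonneg_left (hCS.trans ?_) (by positivity)
  rw [← Real.sqrt_eq_rpow, ← Real.sqrt_eq_rpow]
  calc _ ≤ Real.sqrt (D * S * r ^ (-β)) * Real.sqrt (B * ‖φ‖ ^ 2) := by gcongr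
    _ = _ := by
      rw [Real.sqrt_mul (by positivity), Real.sqrt_mul hB, Real.sqrt_sq (norm_nonneg _),
        Real.sqrt_eq_rpow (r ^ (-β)), ← Real.rpow_mul hr0.le,
        show -β * (1 / 2) = -(β / 2) by ring]
      ring

/-- The function `r ↦ ∂ₓ(S(r)φ)(0)` for a fixed `φ`. Unlike the series of functionals in
`boundaryFlux`, this series converges at `r = 0` too; it is extended to `r < 0` by a constant, which
makes it continuous on the line. -/
def fluxSeries (φ : Test) (r : ℝ) : ℂ :=
  ∑' n : ℤ, 1 / (Real.pi : ℂ) * ((Real.exp (-(n : ℝ) ^ 2 * max 0 r) : ℂ) * cosCoeff n φ)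

theorem norm_fluxSeries_term_le (φ : Test) (r : ℝ) (n : ℤ) :
    ‖1 / (Real.pi : ℂ) * ((Real.exp (-(n : ℝ) ^ 2 * max 0 r) : ℂ) * cosCoeff n φ)‖ ≤
      1 / Real.pi * ‖cosCoeff n φ‖ := by
  rw [norm_mul, norm_mul, norm_real, Real.norm_of_nonneg (Real.exp_pos _).le, norm_div, norm_one,
    norm_real, Real.norm_of_nonneg Real.pi_pos.le]
  have : Real.exp (-(n : ℝ) ^ 2 * max 0 r) ≤ 1 := by
    rw [Real.exp_le_one_iff]; nlinarith [sq_nonneg (n : ℝ), le_max_left 0 r]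
  have hpi := Real.pi_pos
  gcongr
  exact mul_le_of_le_one_left (norm_nonneg _) this

theorem hasSum_fluxSeries (φ : Test) (r : ℝ) :
    HasSum (fun n : ℤ => 1 / (Real.pi : ℂ) *
      ((Real.exp (-(n : ℝ) ^ 2 * max 0 r) : ℂ) * cosCoeff n φ)) (fluxSeries φ r) :=
  (Summable.of_norm_bounded ((summable_norm_cosCoeff φ).mul_left _)
    (norm_fluxSeries_term_le φ r)).hasSum

theorem continuous_fluxSeries (φ : Test) : Continuous (fluxSeries φ) := by
  refine continuous_tsum (fun n => ?_) ((summable_norm_cosCoeff φ).mul_left (1 / Real.pi))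
    fun n r => norm_fluxSeries_term_le φ r n
  fun_prop

theorem exists_norm_fluxSeries_le (φ : Test) : ∃ M, ∀ r, ‖fluxSeries φ r‖ ≤ M :=
  ⟨_, fun r => tsum_of_norm_bounded (((summable_norm_cosCoeff φ).mul_left _).hasSum)
    (norm_fluxSeries_term_le φ r)⟩

theorem fluxSeries_of_pos {r : ℝ} (hr : 0 < r) (φ : Test) : fluxSeries φ r = boundaryFlux r φ := by
  rw [fluxSeries, max_eq_right hr.le]
  exact (hasSum_boundaryFlux hr φ).tsum_eq

theorem fluxSeries_zero (φ : Test) : fluxSeries φ 0 = deriv (φ : ℝ → ℂ) 0 := by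
  rw [fluxSeries, ← (hasSum_cosCoeff_mul_cos φ ⟨le_rfl, Real.pi_pos⟩).tsum_eq]
  simp

theorem fluxSeries_eq_add_integral {φ ψ : Test} (h : ∀ x, ψ x = deriv (deriv φ) x) {r : ℝ}
    (hr : 0 ≤ r) :
    fluxSeries φ r = deriv (φ : ℝ → ℂ) 0 + ∫ ρ in (0 : ℝ)..r, fluxSeries ψ ρ := by
  have h1 : HasSum (fun n : ℤ => ∫ ρ in (0 : ℝ)..r, 1 / (Real.pi : ℂ) *
      ((Real.exp (-(n : ℝ) ^ 2 * max 0 ρ) : ℂ) * cosCoeff n ψ))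
      (∫ ρ in (0 : ℝ)..r, fluxSeries ψ ρ) := by
    refine intervalIntegral.hasSum_integral_of_dominated_convergence
      (fun n _ => 1 / Real.pi * ‖cosCoeff n ψ‖) (fun n => ?_) (fun n => ?_) ?_ ?_ ?_
    · exact Continuous.aestronglyMeasurable (by fun_prop)
    · exact Filter.Eventually.of_forall fun ρ _ => norm_fluxSeries_term_le ψ ρ n
    · exact Filter.Eventually.of_forall fun ρ _ => (summable_norm_cosCoeff ψ).mul_left _
    · exact intervalIntegrable_const
    · exact Filter.Eventually.of_forall fun ρ _ => hasSum_fluxSeries ψ ρ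
  have h2 : ∀ n : ℤ, ∫ ρ in (0 : ℝ)..r, 1 / (Real.pi : ℂ) *
      ((Real.exp (-(n : ℝ) ^ 2 * max 0 ρ) : ℂ) * cosCoeff n ψ) =
      1 / (Real.pi : ℂ) * ((Real.exp (-(n : ℝ) ^ 2 * max 0 r) : ℂ) * cosCoeff n φ) -
      1 / (Real.pi : ℂ) * ((Real.exp (-(n : ℝ) ^ 2 * max 0 0) : ℂ) * cosCoeff n φ) := by
    intro n
    have hd : ∀ x ∈ uIcc 0 r, HasDerivAt (fun x : ℝ => 1 / (Real.pi : ℂ) *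
        ((Real.exp (-(n : ℝ) ^ 2 * x) : ℂ) * cosCoeff n φ))
        (1 / (Real.pi : ℂ) * ((Real.exp (-(n : ℝ) ^ 2 * x) : ℂ) * cosCoeff n ψ)) x := by
      intro x _
      have h3 := ((((hasDerivAt_id x).const_mul (-(n : ℝ) ^ 2)).exp).ofReal_comp.mul_const
        (cosCoeff n φ)).const_mul (1 / (Real.pi : ℂ))
      convert! h3 using 1
      rw [cosCoeff_deriv_deriv h]
      simp only [id_eq, mul_one]
      push_cast
      ring
    have h4 := intervalIntegral.integral_eq_sub_of_hasDerivAt hd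
      (Continuous.intervalIntegrable (by fun_prop) _ _)
    rw [max_eq_right hr, max_eq_right le_rfl, ← h4]
    refine intervalIntegral.integral_congr fun x hx => ?_
    rw [uIcc_of_le hr] at hx
    simp only [max_eq_right hx.1]
  have h5 := (hasSum_fluxSeries φ r).sub (hasSum_fluxSeries φ 0)
  simp_rw [h2] at h1
  rw [h1.unique h5, fluxSeries_zero]
  ring

theorem boundaryFlux_eq_integral_poissonKernel {r : ℝ} (hr : 0 < r) (φ : Test) :
    boundaryFlux r φ = ∫ x in (0 : ℝ)..Real.pi, poissonKernel r x * φ x := by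
  have hφ : Continuous (φ : ℝ → ℂ) := φ.contDiff.continuous
  have h1 : HasSum (fun n : ℤ => ∫ x in (0 : ℝ)..Real.pi,
      1 / (Real.pi : ℂ) * (exp (-(n : ℂ) ^ 2 * r) * (n * sin (n * x))) * φ x)
      (∫ x in (0 : ℝ)..Real.pi, poissonKernel r x * φ x) := by
    refine intervalIntegral.hasSum_integral_of_dominated_convergence
      (fun n x => 1 / Real.pi * (|(n : ℝ)| * Real.exp (-(n : ℝ) ^ 2 * r)) * ‖φ x‖)
      (fun n => ?_) (fun n => ?_) ?_ ?_ ?_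
    · exact Continuous.aestronglyMeasurable (by fun_prop)
    · refine Filter.Eventually.of_forall fun x _ => ?_
      have hs : ‖sin ((n : ℂ) * x)‖ ≤ 1 := by
        rw [← ofReal_intCast, ← ofReal_mul, ← ofReal_sin, norm_real]
        exact Real.abs_sin_le_one _
      have he : exp (-(n : ℂ) ^ 2 * r) = ((Real.exp (-(n : ℝ) ^ 2 * r) : ℝ) : ℂ) := by
        push_cast; rfl
      rw [he, norm_mul, norm_mul, norm_mul, norm_mul, norm_real, Complex.norm_intCast,
        Real.norm_of_nonneg (Real.exp_pos _).le, norm_div, norm_one,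
        norm_real, Real.norm_of_nonneg Real.pi_pos.le, mul_comm (Real.exp _)]
      have hpi := Real.pi_pos
      gcongr
      exact mul_le_of_le_one_right (abs_nonneg _) hs
    · exact Filter.Eventually.of_forall fun x _ =>
        ((summable_abs_mul_exp_neg_sq_mul hr).mul_left _).mul_right _
    · simp_rw [tsum_mul_right]
      exact Continuous.intervalIntegrable (by fun_prop) _ _
    · exact Filter.Eventually.of_forall fun x _ => (hasSum_poissonKernel hr x).mul_right _
  refine (hasSum_boundaryFlux hr φ).unique ?_
  convert! h1 using 1
  funext n
  rw [cosCoeff_eq_sin, ← intervalIntegral.integral_const_mul, ← intervalIntegral.integral_const_mul,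
    ← intervalIntegral.integral_const_mul]
  congr 1
  funext x
  push_cast
  ring

/-! ### Duhamel integrals with a singular kernel -/

theorem exists_integral_norm_mul_rpow_le {τ ν : ℝ} (hτ : 0 < τ) (hν : ν < 1 / 2) {w : ℝ → ℂ}
    (hw : MemLp w 2 (volume.restrict (Icc 0 τ))) :
    ∃ M : ℝ, 0 ≤ M ∧ ∀ t ∈ Icc 0 τ,
      IntervalIntegrable (fun σ => ‖w σ‖ * (t - σ) ^ (-ν)) volume 0 t ∧
      ∫ σ in (0 : ℝ)..t, ‖w σ‖ * (t - σ) ^ (-ν) ≤ M := by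
  have hw2 : IntervalIntegrable (fun σ => ‖w σ‖ ^ 2) volume 0 τ := by
    rw [intervalIntegrable_iff_integrableOn_Icc_of_le hτ.le]
    exact (memLp_two_iff_integrable_sq_norm hw.aestronglyMeasurable).1 hw
  have hν' : -1 < -(2 * ν) := by linarith
  have hν1 : 0 < -(2 * ν) + 1 := by linarith
  refine ⟨(∫ σ in (0 : ℝ)..τ, ‖w σ‖ ^ 2) / 2 + τ ^ (-(2 * ν) + 1) / (-(2 * ν) + 1) / 2, ?_,
    fun t ht => ?_⟩
  · have := intervalIntegral.integral_nonneg hτ.le (f := fun σ => ‖w σ‖ ^ 2) (μ := volume)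
      fun _ _ => sq_nonneg _
    positivity
  have hwt : IntervalIntegrable (fun σ => ‖w σ‖ ^ 2) volume 0 t := by
    refine hw2.mono_set ?_
    rw [uIcc_of_le ht.1, uIcc_of_le hτ.le]
    exact Icc_subset_Icc_right ht.2
  have hpow : IntervalIntegrable (fun σ => (t - σ) ^ (-(2 * ν))) volume 0 t := by
    have h := (intervalIntegral.intervalIntegrable_rpow' hν' (a := 0) (b := t)).comp_sub_left t
    simp only [sub_zero, sub_self] at h
    exact h.symm
  have hg : IntervalIntegrable (fun σ => ‖w σ‖ ^ 2 / 2 + (t - σ) ^ (-(2 * ν)) / 2) volume 0 t :=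
    (hwt.div_const 2).add (hpow.div_const 2)
  have hle : ∀ σ ∈ Ioc 0 t, ‖w σ‖ * (t - σ) ^ (-ν) ≤
      ‖w σ‖ ^ 2 / 2 + (t - σ) ^ (-(2 * ν)) / 2 := by
    intro σ hσ
    have h0 : 0 ≤ t - σ := sub_nonneg.2 hσ.2
    have : (t - σ) ^ (-(2 * ν)) = ((t - σ) ^ (-ν)) ^ 2 := by
      rw [← Real.rpow_natCast, ← Real.rpow_mul h0]; congr 1; push_cast; ring
    rw [this]
    nlinarith [sq_nonneg (‖w σ‖ - (t - σ) ^ (-ν))]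
  have hmeas : AEStronglyMeasurable (fun σ => ‖w σ‖ * (t - σ) ^ (-ν))
      (volume.restrict (uIoc 0 t)) := by
    rw [uIoc_of_le ht.1]
    refine (hw.aestronglyMeasurable.mono_measure (Measure.restrict_mono
      (Ioc_subset_Icc_self.trans (Icc_subset_Icc_right ht.2)) le_rfl)).norm.mul ?_
    exact Measurable.aestronglyMeasurable (by fun_prop)
  have hint : IntervalIntegrable (fun σ => ‖w σ‖ * (t - σ) ^ (-ν)) volume 0 t := by
    refine hg.mono_fun' hmeas ?_
    rw [uIoc_of_le ht.1]
    refine (ae_restrict_iff' measurableSet_Ioc).2 (Filter.Eventually.of_forall fun σ hσ => ?_)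
    dsimp only
    rw [Real.norm_of_nonneg (mul_nonneg (norm_nonneg _) (Real.rpow_nonneg (sub_nonneg.2 hσ.2) _))]
    exact hle σ hσ
  refine ⟨hint, ?_⟩
  calc ∫ σ in (0 : ℝ)..t, ‖w σ‖ * (t - σ) ^ (-ν)
      ≤ ∫ σ in (0 : ℝ)..t, (‖w σ‖ ^ 2 / 2 + (t - σ) ^ (-(2 * ν)) / 2) :=
        intervalIntegral.integral_mono_on_of_le_Ioo ht.1 hint hg
          fun σ hσ => hle σ (Ioo_subset_Ioc_self hσ)
    _ = (∫ σ in (0 : ℝ)..t, ‖w σ‖ ^ 2) / 2 + t ^ (-(2 * ν) + 1) / (-(2 * ν) + 1) / 2 := by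
        rw [intervalIntegral.integral_add (hwt.div_const 2) (hpow.div_const 2),
          intervalIntegral.integral_div, intervalIntegral.integral_div,
          intervalIntegral.integral_comp_sub_left (fun x => x ^ (-(2 * ν))), sub_self, sub_zero,
          integral_rpow (Or.inl hν'), Real.zero_rpow hν1.ne', sub_zero]
    _ ≤ _ := by
        have h1 : ∫ σ in (0 : ℝ)..t, ‖w σ‖ ^ 2 ≤ ∫ σ in (0 : ℝ)..τ, ‖w σ‖ ^ 2 :=
          intervalIntegral.integral_mono_interval le_rfl ht.1 ht.2
            (Filter.Eventually.of_forall fun _ => sq_nonneg _) hw2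
        have h2 : t ^ (-(2 * ν) + 1) ≤ τ ^ (-(2 * ν) + 1) :=
          Real.rpow_le_rpow ht.1 ht.2 hν1.le
        gcongr

/-- The weighted scalar input `(τ - σ)^{-γ} w(σ)`. -/
def weightedScalar (τ γ : ℝ) (w : ℝ → ℂ) (σ : ℝ) : ℂ := (((τ - σ) ^ (-γ) : ℝ) : ℂ) * w σ

section Convolution

variable {E : Type*} [NormedAddCommGroup E] [NormedSpace ℂ E]
  {τ α γ C : ℝ} {T : ℝ → E} {w : ℝ → ℂ}

theorem aestronglyMeasurable_weightedScalar (hw : MemLp w 2 (volume.restrict (Icc 0 τ))) :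
    AEStronglyMeasurable (weightedScalar τ γ w) (volume.restrict (Icc 0 τ)) := by
  refine AEStronglyMeasurable.mul ?_ hw.aestronglyMeasurable
  exact Measurable.aestronglyMeasurable (by fun_prop)

theorem norm_weightedScalar_le (hγ : 0 ≤ γ) {σ t : ℝ} (hσ : σ < t) (ht : t ≤ τ) :
    ‖weightedScalar τ γ w σ‖ ≤ ‖w σ‖ * (t - σ) ^ (-γ) := by
  rw [weightedScalar, norm_mul, norm_real,
    Real.norm_of_nonneg (Real.rpow_nonneg (by linarith) _), mul_comm]
  refine mul_le_mul_of_nonneg_left ?_ (norm_nonneg _)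
  exact Real.rpow_le_rpow_of_nonpos (by linarith) (by linarith) (by linarith)

theorem integrableOn_weightedScalar (hτ : 0 < τ) (hγ : 0 ≤ γ) (hγ2 : γ < 1 / 2)
    (hw : MemLp w 2 (volume.restrict (Icc 0 τ))) :
    IntegrableOn (weightedScalar τ γ w) (Icc 0 τ) := by
  obtain ⟨M, _, h⟩ := exists_integral_norm_mul_rpow_le hτ hγ2 hw
  have h1 := (h τ ⟨hτ.le, le_rfl⟩).1
  rw [intervalIntegrable_iff_integrableOn_Icc_of_le hτ.le] at h1
  refine h1.mono' (aestronglyMeasurable_weightedScalar hw) ?_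
  rw [← restrict_Ico_eq_restrict_Icc]
  refine (ae_restrict_iff' measurableSet_Ico).2 (Filter.Eventually.of_forall fun σ hσ => ?_)
  exact norm_weightedScalar_le hγ hσ.2 le_rfl

theorem norm_weightedScalar_smul_le (hγ : 0 ≤ γ)
    (hTb : ∀ r ∈ Ioc 0 τ, ‖T r‖ ≤ C * r ^ (-α)) {σ t : ℝ} (hσ0 : 0 < σ) (hσ : σ < t) (ht : t ≤ τ) :
    ‖weightedScalar τ γ w σ • T (t - σ)‖ ≤ C * (‖w σ‖ * (t - σ) ^ (-(α + γ))) := by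
  have h0 : 0 < t - σ := sub_pos.2 hσ
  rw [norm_smul, neg_add, Real.rpow_add h0]
  calc _ ≤ (‖w σ‖ * (t - σ) ^ (-γ)) * (C * (t - σ) ^ (-α)) := by
        gcongr
        · exact norm_weightedScalar_le hγ hσ ht
        · exact hTb _ ⟨h0, by linarith⟩
    _ = _ := by ring

theorem intervalIntegrable_weightedScalar_smul (hτ : 0 < τ) (hγ : 0 ≤ γ) (hαγ : α + γ < 1 / 2)
    (hT : ContinuousOn T (Ioi 0)) (hTb : ∀ r ∈ Ioc 0 τ, ‖T r‖ ≤ C * r ^ (-α))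
    (hw : MemLp w 2 (volume.restrict (Icc 0 τ))) {t : ℝ} (ht : t ∈ Icc 0 τ) :
    IntervalIntegrable (fun σ => weightedScalar τ γ w σ • T (t - σ)) volume 0 t := by
  obtain ⟨M, _, h⟩ := exists_integral_norm_mul_rpow_le hτ hαγ hw
  have h1 := (h t ht).1.const_mul C
  rw [intervalIntegrable_iff_integrableOn_Ioo_of_le ht.1] at h1 ⊢
  refine h1.mono' ?_ ?_
  · refine ((aestronglyMeasurable_weightedScalar hw).mono_measure (Measure.restrict_mono
      (Ioo_subset_Icc_self.trans (Icc_subset_Icc_right ht.2)) le_rfl)).smul ?_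
    refine ContinuousOn.aestronglyMeasurable ?_ measurableSet_Ioo
    exact hT.comp (by fun_prop) fun σ hσ => sub_pos.2 hσ.2
  · refine (ae_restrict_iff' measurableSet_Ioo).2 (Filter.Eventually.of_forall fun σ hσ => ?_)
    exact norm_weightedScalar_smul_le hγ hTb hσ.1 hσ.2 ht.2

/-- The Duhamel integral is the uniform limit of the integrals with kernel cut off near its
singularity at `0`, and these are continuous by dominated convergence. -/
theorem continuousOn_integral_weightedScalar_smul (hτ : 0 < τ) (hα : 0 ≤ α) (hγ : 0 ≤ γ)
    (hαγ : α + γ < 1 / 2)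
    (hC : 0 ≤ C) (hT : ContinuousOn T (Ioi 0)) (hTb : ∀ r ∈ Ioc 0 τ, ‖T r‖ ≤ C * r ^ (-α))
    (hw : MemLp w 2 (volume.restrict (Icc 0 τ))) :
    ContinuousOn (fun t => ∫ σ in (0 : ℝ)..t, weightedScalar τ γ w σ • T (t - σ)) (Icc 0 τ) := by
  set μ := α + γ with hμ
  obtain ⟨M, hM, hMt⟩ := exists_integral_norm_mul_rpow_le (ν := (μ + 1 / 2) / 2) hτ
    (by linarith) hw
  -- the exponents satisfy `μ + κ = (μ + 1 / 2) / 2 < 1 / 2`, so a factor `r ^ κ` can be split off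
  set κ := (1 / 2 - μ) / 2 with hκ
  have hκ0 : 0 < κ := by rw [hκ]; linarith
  refine continuousOn_of_uniform_approx_of_continuousOn fun u hu => ?_
  obtain ⟨η, hη, hηu⟩ := Metric.mem_uniformity_dist.1 hu
  -- the error of the cutoff at scale `ε` is at most `C * (2 * ε) ^ κ * M`
  set ε := (η / (C * M + 1)) ^ κ⁻¹ / 2 with hε
  have hε0 : 0 < ε := by positivity
  have hsmall : C * ((2 * ε) ^ κ * M) < η := by
    rw [hε, mul_div_cancel₀ _ (two_ne_zero), ← Real.rpow_mul (by positivity),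
      inv_mul_cancel₀ hκ0.ne', Real.rpow_one]
    rw [show C * (η / (C * M + 1) * M) = η * (C * M) / (C * M + 1) by ring,
      div_lt_iff₀ (by positivity)]
    nlinarith
  set χ : ℝ → ℝ := fun r => max 0 (min 1 (r / ε - 1)) with hχ
  have hχ0 : ∀ r, r ≤ ε → χ r = 0 := by
    intro r hr
    have : r / ε ≤ 1 := (div_le_one hε0).2 hr
    rw [hχ]; dsimp only
    rw [max_eq_left]
    exact (min_le_right _ _).trans (by linarith)
  have hχ1 : ∀ r, 2 * ε ≤ r → χ r = 1 := by
    intro r hr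
    have : 2 ≤ r / ε := (le_div_iff₀ hε0).2 hr
    rw [hχ]; dsimp only
    rw [min_eq_left (by linarith), max_eq_right zero_le_one]
  have hχn : ∀ r, 0 ≤ χ r := fun r => le_max_left _ _
  have hχl : ∀ r, χ r ≤ 1 := fun r => max_le zero_le_one (min_le_left _ _)
  have hχc : Continuous χ := by rw [hχ]; fun_prop
  -- the kernel cut off near its singularity; the minimum keeps it bounded beyond `τ`, where no
  -- bound on `T` is available
  set S : ℝ → E := fun r => (χ r : ℂ) • T (min r τ) with hS
  have hSc : Continuous S := by
    rw [continuous_iff_continuousAt]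
    intro r
    rcases lt_or_ge r ε with hr | hr
    · have : S =ᶠ[nhds r] fun _ => 0 := by
        filter_upwards [Iio_mem_nhds hr] with x hx
        have hx' : x < ε := hx
        rw [hS]; dsimp only
        rw [hχ0 x hx'.le, ofReal_zero, zero_smul]
      exact continuousAt_const.congr this.symm
    · have h1 : 0 < min r τ := lt_min (hε0.trans_le hr) hτ
      have h2 : ContinuousAt T (min r τ) := hT.continuousAt (Ioi_mem_nhds h1)
      have h3 : ContinuousAt (fun r => T (min r τ)) r :=
        ContinuousAt.comp (f := fun r : ℝ => min r τ) h2 (by fun_prop)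
      exact ContinuousAt.smul (by fun_prop) h3
  have hSb : ∀ r, ‖S r‖ ≤ C * (min ε τ) ^ (-α) := by
    intro r
    rcases le_or_gt r ε with hr | hr
    · rw [hS]; dsimp only
      rw [hχ0 r hr, ofReal_zero, zero_smul, norm_zero]; positivity
    · rw [hS]; dsimp only
      have h1 : 0 < min r τ := lt_min (hε0.trans hr) hτ
      have h2 : min ε τ ≤ min r τ := min_le_min_right _ hr.le
      rw [norm_smul, norm_real, Real.norm_of_nonneg (hχn r)]
      refine (mul_le_of_le_one_left (norm_nonneg _) (hχl r)).trans ?_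
      refine (hTb _ ⟨h1, min_le_right _ _⟩).trans ?_
      exact mul_le_mul_of_nonneg_left (Real.rpow_le_rpow_of_nonpos (lt_min hε0 hτ) h2
        (by linarith)) hC
  have hv : IntervalIntegrable (weightedScalar τ γ w) volume 0 τ := by
    rw [intervalIntegrable_iff_integrableOn_Icc_of_le hτ.le]
    exact integrableOn_weightedScalar hτ hγ (by linarith) hw
  have hvm : AEStronglyMeasurable (weightedScalar τ γ w) (volume.restrict (uIoc 0 τ)) := by
    rw [uIoc_of_le hτ.le, restrict_Ioc_eq_restrict_Icc]
    exact aestronglyMeasurable_weightedScalar hw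
  have hSm : ∀ t : ℝ, AEStronglyMeasurable (fun σ => S (t - σ)) (volume.restrict (uIoc 0 τ)) :=
    fun t => Continuous.aestronglyMeasurable (by fun_prop)
  refine ⟨fun t => ∫ σ in (0 : ℝ)..τ, weightedScalar τ γ w σ • S (t - σ), ?_, fun t ht => ?_⟩
  · refine Continuous.continuousOn ?_
    refine intervalIntegral.continuous_of_dominated_interval
      (bound := fun σ => ‖weightedScalar τ γ w σ‖ * (C * (min ε τ) ^ (-α))) (fun t => ?_)
      (fun t => ?_) ?_ ?_
    · exact hvm.smul (hSm t)
    · refine Filter.Eventually.of_forall fun σ _ => ?_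
      rw [norm_smul]
      exact mul_le_mul_of_nonneg_left (hSb _) (norm_nonneg _)
    · exact hv.norm.mul_const _
    · refine Filter.Eventually.of_forall fun σ _ => ?_
      exact continuous_const.smul (hSc.comp (by fun_prop))
  · apply hηu
    have hvS : ∀ a ∈ Icc 0 τ, ∀ b ∈ Icc 0 τ,
        IntervalIntegrable (fun σ => weightedScalar τ γ w σ • S (t - σ)) volume a b := by
      have h0 : IntervalIntegrable (fun σ => weightedScalar τ γ w σ • S (t - σ)) volume 0 τ := by
        refine (hv.norm.mul_const (C * (min ε τ) ^ (-α))).mono_fun' (hvm.smul (hSm t)) ?_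
        refine Filter.Eventually.of_forall fun σ => ?_
        dsimp only
        rw [norm_smul]
        exact mul_le_mul_of_nonneg_left (hSb _) (norm_nonneg _)
      intro a ha b hb
      refine h0.mono_set ?_
      rw [uIcc_of_le hτ.le]
      exact uIcc_subset_Icc ha hb
    have htail : ∫ σ in t..τ, weightedScalar τ γ w σ • S (t - σ) = 0 := by
      refine intervalIntegral.integral_zero_ae (Filter.Eventually.of_forall fun σ hσ => ?_)
      rw [uIoc_of_le ht.2] at hσ
      rw [hS]; dsimp only
      rw [hχ0 _ (by linarith [hσ.1]), ofReal_zero, zero_smul, smul_zero]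
    rw [dist_eq_norm]
    beta_reduce
    rw [← intervalIntegral.integral_add_adjacent_intervals
      (hvS 0 ⟨le_rfl, hτ.le⟩ t ht) (hvS t ht τ ⟨hτ.le, le_rfl⟩), htail, add_zero,
      ← intervalIntegral.integral_sub
        (intervalIntegrable_weightedScalar_smul hτ hγ hαγ hT hTb hw ht)
        (hvS 0 ⟨le_rfl, hτ.le⟩ t ht)]
    obtain ⟨hint, hleM⟩ := hMt t ht
    refine lt_of_le_of_lt (intervalIntegral.norm_integral_le_of_norm_le ht.1
      (g := fun σ => C * ((2 * ε) ^ κ * (‖w σ‖ * (t - σ) ^ (-((μ + 1 / 2) / 2))))) ?_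
      ((hint.const_mul _).const_mul _)) ?_
    · have hne : ∀ᵐ σ : ℝ, σ ≠ t := by
        simp [ae_iff]
      filter_upwards [hne] with σ hσt hσ
      have hlt : σ < t := lt_of_le_of_ne hσ.2 hσt
      have hr0 : 0 < t - σ := sub_pos.2 hlt
      have hmin : min (t - σ) τ = t - σ := min_eq_left (by linarith [hσ.1, ht.2])
      rw [hS]; dsimp only
      rw [hmin]
      rcases le_or_gt (2 * ε) (t - σ) with h2 | h2
      · rw [hχ1 _ h2, ofReal_one, one_smul, sub_self, norm_zero]
        have := Real.rpow_nonneg hr0.le (-((μ + 1 / 2) / 2))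
        positivity
      · have e1 : weightedScalar τ γ w σ • T (t - σ) -
            weightedScalar τ γ w σ • ((χ (t - σ) : ℂ) • T (t - σ)) =
            ((1 - χ (t - σ) : ℝ) : ℂ) • (weightedScalar τ γ w σ • T (t - σ)) := by
          push_cast
          rw [sub_smul, one_smul, smul_comm]
        rw [e1, norm_smul, norm_real, Real.norm_of_nonneg (by linarith [hχl (t - σ)])]
        refine (mul_le_of_le_one_left (norm_nonneg _) (by linarith [hχn (t - σ)])).trans ?_
        refine (norm_weightedScalar_smul_le hγ hTb hσ.1 hlt ht.2).trans ?_
        have e2 : (t - σ) ^ (-μ) = (t - σ) ^ κ * (t - σ) ^ (-((μ + 1 / 2) / 2)) := by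
          rw [← Real.rpow_add hr0]; congr 1; rw [hκ]; ring
        rw [← hμ, e2]
        have e3 : (t - σ) ^ κ ≤ (2 * ε) ^ κ := Real.rpow_le_rpow hr0.le h2.le hκ0.le
        have := Real.rpow_nonneg hr0.le (-((μ + 1 / 2) / 2))
        calc _ = C * ((t - σ) ^ κ * (‖w σ‖ * (t - σ) ^ (-((μ + 1 / 2) / 2)))) := by ring
          _ ≤ _ := by gcongr
    · rw [intervalIntegral.integral_const_mul, intervalIntegral.integral_const_mul]
      refine lt_of_le_of_lt ?_ hsmall
      gcongr

/-- Fubini's theorem on the triangle `0 < σ < s < t`. -/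
theorem integral_mul_integral_eq {v h : ℝ → ℂ} {M t : ℝ} (ht : 0 ≤ t)
    (hv : IntervalIntegrable v volume 0 t) (hh : Continuous h) (hM : ∀ r, ‖h r‖ ≤ M) :
    ∫ σ in (0 : ℝ)..t, v σ * ∫ ρ in (0 : ℝ)..(t - σ), h ρ =
      ∫ s in (0 : ℝ)..t, ∫ σ in (0 : ℝ)..s, v σ * h (s - σ) := by
  have hv' : Integrable v (volume.restrict (Ioc 0 t)) :=
    (intervalIntegrable_iff_integrableOn_Ioc_of_le ht).1 hv
  set k : ℝ → ℝ → ℂ := fun σ s => {p : ℝ × ℝ | p.1 < p.2}.indicator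
    (fun p => h (p.2 - p.1)) (σ, s) * v σ with hk
  have hset : MeasurableSet {p : ℝ × ℝ | p.1 < p.2} := measurableSet_lt measurable_fst measurable_snd
  have hkint : Integrable (Function.uncurry k)
      ((volume.restrict (Ioc 0 t)).prod (volume.restrict (Ioc 0 t))) := by
    refine Integrable.bdd_mul (c := M) (hv'.comp_fst (volume.restrict (Ioc 0 t))) ?_ ?_
    · exact ((hh.comp (by fun_prop)).measurable.indicator hset).aestronglyMeasurable
    · refine Filter.Eventually.of_forall fun p => ?_
      exact (norm_indicator_le_norm_self _ _).trans (hM _)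
  have hswap := integral_integral_swap hkint
  have hL : ∀ σ ∈ Ioc 0 t, ∫ s in Ioc 0 t, k σ s = v σ * ∫ ρ in (0 : ℝ)..(t - σ), h ρ := by
    intro σ hσ
    have e1 : ∀ s, k σ s = (Ioi σ).indicator (fun s => h (s - σ) * v σ) s := by
      intro s
      by_cases hs : σ < s
      · rw [hk]; dsimp only
        rw [indicator_of_mem (show (σ, s) ∈ {p : ℝ × ℝ | p.1 < p.2} from hs),
          indicator_of_mem (show s ∈ Ioi σ from hs)]
      · rw [hk]; dsimp only
        rw [indicator_of_notMem (show (σ, s) ∉ {p : ℝ × ℝ | p.1 < p.2} from hs),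
          indicator_of_notMem (show s ∉ Ioi σ from hs), zero_mul]
    simp_rw [e1]
    have e2 : Ioc 0 t ∩ Ioi σ = Ioc σ t := by
      ext s; simp only [mem_inter_iff, mem_Ioc, mem_Ioi]
      constructor
      · rintro ⟨⟨_, h2⟩, h3⟩; exact ⟨h3, h2⟩
      · rintro ⟨h1, h2⟩; exact ⟨⟨hσ.1.trans h1, h2⟩, h1⟩
    rw [setIntegral_indicator measurableSet_Ioi, e2, ← intervalIntegral.integral_of_le hσ.2,
      intervalIntegral.integral_mul_const, mul_comm,
      intervalIntegral.integral_comp_sub_right (fun ρ => h ρ), sub_self]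
  have hR : ∀ s ∈ Ioc 0 t, ∫ σ in Ioc 0 t, k σ s = ∫ σ in (0 : ℝ)..s, v σ * h (s - σ) := by
    intro s hs
    have e1 : ∀ σ, k σ s = (Iio s).indicator (fun σ => v σ * h (s - σ)) σ := by
      intro σ
      by_cases hs : σ < s
      · rw [hk]; dsimp only
        rw [indicator_of_mem (show (σ, s) ∈ {p : ℝ × ℝ | p.1 < p.2} from hs),
          indicator_of_mem (show σ ∈ Iio s from hs), mul_comm]
      · rw [hk]; dsimp only
        rw [indicator_of_notMem (show (σ, s) ∉ {p : ℝ × ℝ | p.1 < p.2} from hs),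
          indicator_of_notMem (show σ ∉ Iio s from hs), zero_mul]
    simp_rw [e1]
    have e2 : Ioc 0 t ∩ Iio s = Ioo 0 s := by
      ext σ; simp only [mem_inter_iff, mem_Ioc, mem_Iio, mem_Ioo]
      constructor
      · rintro ⟨⟨h1, _⟩, h3⟩; exact ⟨h1, h3⟩
      · rintro ⟨h1, h2⟩; exact ⟨⟨h1, h2.le.trans hs.2⟩, h2⟩
    rw [setIntegral_indicator measurableSet_Iio, e2, ← integral_Ioc_eq_integral_Ioo,
      ← intervalIntegral.integral_of_le hs.1.le]
  rw [intervalIntegral.integral_of_le ht, intervalIntegral.integral_of_le ht,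
    ← setIntegral_congr_fun measurableSet_Ioc hL, ← setIntegral_congr_fun measurableSet_Ioc hR]
  exact hswap

end Convolution

/-! ### Reflection of the interval -/

/-- Evaluation of the derivative at a point, as a linear map. -/
def Test.derivAt (x : ℝ) : Test →ₗ[ℂ] ℂ where
  toFun φ := deriv (φ : ℝ → ℂ) x
  map_add' φ ψ := deriv_add (φ.differentiable x) (ψ.differentiable x)
  map_smul' c φ := deriv_const_smul c (φ.differentiable x)

theorem Test.derivAt_apply (x : ℝ) (φ : Test) : Test.derivAt x φ = deriv (φ : ℝ → ℂ) x := rfl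

/-- The test function `x ↦ φ(π - x)`. -/
def Test.reflectFun (φ : Test) : Test :=
  ⟨fun x => φ (Real.pi - x), φ.contDiff.comp (contDiff_const.sub contDiff_id), by
    have : φ Real.pi = 0 := φ.2.2.2
    simpa using this, by
    have : φ 0 = 0 := φ.2.2.1
    simpa using this⟩

theorem Test.deriv_reflectFun (φ : Test) (x : ℝ) :
    deriv (φ.reflectFun : ℝ → ℂ) x = -deriv (φ : ℝ → ℂ) (Real.pi - x) :=
  deriv_comp_const_sub (f := (φ : ℝ → ℂ)) (a := Real.pi) (x := x)

theorem Test.norm_reflectFun (φ : Test) : ‖φ.reflectFun‖ = ‖φ‖ := by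
  have h : ‖φ.reflectFun‖ₑ ^ 2 = ‖φ‖ₑ ^ 2 := by
    rw [Test.enorm_sq, Test.enorm_sq, ← lintegral_indicator measurableSet_Icc,
      ← lintegral_indicator measurableSet_Icc,
      ← lintegral_sub_left_eq_self (μ := volume) _ Real.pi]
    congr 1
    funext x
    by_cases hx : x ∈ Icc 0 Real.pi
    · rw [indicator_of_mem, indicator_of_mem hx, φ.deriv_reflectFun, sub_sub_cancel, enorm_neg]
      exact ⟨by linarith [hx.2], by linarith [hx.1]⟩
    · rw [indicator_of_notMem, indicator_of_notMem hx]
      intro h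
      exact hx ⟨by linarith [h.2], by linarith [h.1]⟩
  rw [enorm_sq_eq_ofReal, enorm_sq_eq_ofReal,
    ENNReal.ofReal_eq_ofReal_iff (sq_nonneg _) (sq_nonneg _)] at h
  exact (sq_eq_sq₀ (norm_nonneg _) (norm_nonneg _)).1 h

/-- The reflection `φ ↦ φ(π - ·)`, which exchanges the two endpoints. -/
def reflect : Test →L[ℂ] Test :=
  LinearMap.mkContinuous
    { toFun := Test.reflectFun
      map_add' := fun _ _ => rfl
      map_smul' := fun _ _ => rfl } 1 fun φ => by
        rw [one_mul]; exact φ.norm_reflectFun.le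

theorem reflect_apply (φ : Test) (x : ℝ) : reflect φ x = φ (Real.pi - x) := rfl

theorem deriv_reflect (φ : Test) (x : ℝ) :
    deriv (reflect φ : ℝ → ℂ) x = -deriv (φ : ℝ → ℂ) (Real.pi - x) := φ.deriv_reflectFun x

theorem reflect_deriv_deriv {φ ψ : Test} (h : ∀ x, ψ x = deriv (deriv φ) x) (x : ℝ) :
    reflect ψ x = deriv (deriv (reflect φ)) x := by
  have h1 : deriv (reflect φ : ℝ → ℂ) = fun x => -deriv (φ : ℝ → ℂ) (Real.pi - x) :=
    funext (deriv_reflect φ)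
  rw [h1, deriv.fun_neg, deriv_comp_const_sub (f := deriv (φ : ℝ → ℂ)), neg_neg, reflect_apply, h]

/-! ### Existence of solutions -/

/-- The state at time `t` for the boundary value `(τ - σ)^{-γ} w(σ)` at the endpoint `0`. -/
def inputState (τ γ : ℝ) (w : ℝ → ℂ) (t : ℝ) : WNeg :=
  ∫ σ in (0 : ℝ)..t, weightedScalar τ γ w σ • boundaryFlux (t - σ)

section Single
variable {τ γ : ℝ} {w : ℝ → ℂ}

theorem continuousOn_inputState (hτ : 0 < τ) (hγ : 0 ≤ γ) (hγ4 : γ < 1 / 4)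
    (hw : MemLp w 2 (volume.restrict (Icc 0 τ))) :
    ContinuousOn (inputState τ γ w) (Icc 0 τ) := by
  -- the exponent `α = β / 2` of the flux has `1 / 4 < α` and `α + γ < 1 / 2`
  obtain ⟨C, hC, hb⟩ := exists_norm_boundaryFlux_le (β := 3 / 4 - γ) (by linarith) τ
  exact continuousOn_integral_weightedScalar_smul hτ (by linarith) hγ (by linarith) hC
    continuousOn_boundaryFlux hb hw

theorem inputState_apply (hτ : 0 < τ) (hγ : 0 ≤ γ) (hγ4 : γ < 1 / 4)
    (hw : MemLp w 2 (volume.restrict (Icc 0 τ))) (φ : Test) {t : ℝ} (ht : t ∈ Icc 0 τ) :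
    inputState τ γ w t φ =
      ∫ σ in (0 : ℝ)..t, weightedScalar τ γ w σ * boundaryFlux (t - σ) φ := by
  obtain ⟨C, hC, hb⟩ := exists_norm_boundaryFlux_le (β := 3 / 4 - γ) (by linarith) τ
  have h := intervalIntegrable_weightedScalar_smul hτ hγ (by linarith)
    continuousOn_boundaryFlux hb hw ht
  exact (ContinuousLinearMap.intervalIntegral_comp_comm
    (ContinuousLinearMap.apply ℂ ℂ φ : WNeg →L[ℂ] ℂ) h).symm

theorem inputState_apply_eq_fluxSeries (hτ : 0 < τ) (hγ : 0 ≤ γ) (hγ4 : γ < 1 / 4)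
    (hw : MemLp w 2 (volume.restrict (Icc 0 τ))) (φ : Test) {t : ℝ} (ht : t ∈ Icc 0 τ) :
    inputState τ γ w t φ =
      ∫ σ in (0 : ℝ)..t, weightedScalar τ γ w σ * fluxSeries φ (t - σ) := by
  rw [inputState_apply hτ hγ hγ4 hw φ ht, intervalIntegral.integral_of_le ht.1,
    intervalIntegral.integral_of_le ht.1, integral_Ioc_eq_integral_Ioo,
    integral_Ioc_eq_integral_Ioo]
  refine setIntegral_congr_fun measurableSet_Ioo fun σ hσ => ?_
  rw [fluxSeries_of_pos (sub_pos.2 hσ.2)]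

theorem intervalIntegrable_weightedScalar (hτ : 0 < τ) (hγ : 0 ≤ γ) (hγ4 : γ < 1 / 4)
    (hw : MemLp w 2 (volume.restrict (Icc 0 τ))) {t : ℝ} (ht : t ∈ Icc 0 τ) :
    IntervalIntegrable (weightedScalar τ γ w) volume 0 t := by
  rw [intervalIntegrable_iff_integrableOn_Icc_of_le ht.1]
  exact (integrableOn_weightedScalar hτ hγ (by linarith) hw).mono_set (Icc_subset_Icc_right ht.2)

theorem inputState_equation (hτ : 0 < τ) (hγ : 0 ≤ γ) (hγ4 : γ < 1 / 4)
    (hw : MemLp w 2 (volume.restrict (Icc 0 τ))) {φ ψ : Test}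
    (h : ∀ x, ψ x = deriv (deriv φ) x) {t : ℝ} (ht : t ∈ Icc 0 τ) :
    inputState τ γ w t φ = ∫ σ in (0 : ℝ)..t,
      (inputState τ γ w σ ψ + weightedScalar τ γ w σ * deriv (φ : ℝ → ℂ) 0) := by
  obtain ⟨M, hM⟩ := exists_norm_fluxSeries_le ψ
  have hv := intervalIntegrable_weightedScalar hτ hγ hγ4 hw ht
  have hstate : IntervalIntegrable (fun σ => inputState τ γ w σ ψ) volume 0 t := by
    refine ContinuousOn.intervalIntegrable ?_
    rw [uIcc_of_le ht.1]
    exact ((continuousOn_inputState hτ hγ hγ4 hw).mono (Icc_subset_Icc_right ht.2)).clm_apply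
      continuousOn_const
  have e1 : ∀ σ ∈ uIcc 0 t, weightedScalar τ γ w σ * fluxSeries φ (t - σ) =
      weightedScalar τ γ w σ * deriv (φ : ℝ → ℂ) 0 +
        weightedScalar τ γ w σ * ∫ ρ in (0 : ℝ)..(t - σ), fluxSeries ψ ρ := by
    intro σ hσ
    rw [uIcc_of_le ht.1] at hσ
    rw [fluxSeries_eq_add_integral h (sub_nonneg.2 hσ.2), mul_add]
  have hprim : Continuous fun σ => ∫ ρ in (0 : ℝ)..(t - σ), fluxSeries ψ ρ := by
    have : Continuous fun x => ∫ ρ in (0 : ℝ)..x, fluxSeries ψ ρ :=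
      intervalIntegral.continuous_primitive
        (fun a b => (continuous_fluxSeries ψ).intervalIntegrable a b) 0
    exact this.comp (by fun_prop)
  rw [inputState_apply_eq_fluxSeries hτ hγ hγ4 hw φ ht, intervalIntegral.integral_congr e1,
    intervalIntegral.integral_add (hv.mul_const _) (hv.mul_continuousOn hprim.continuousOn),
    integral_mul_integral_eq ht.1 hv (continuous_fluxSeries ψ) hM,
    intervalIntegral.integral_add hstate (hv.mul_const _), add_comm]
  congr 1
  refine intervalIntegral.integral_congr fun s hs => ?_
  rw [uIcc_of_le ht.1] at hs
  exact (inputState_apply_eq_fluxSeries hτ hγ hγ4 hw ψ ⟨hs.1, hs.2.trans ht.2⟩).symm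

end Single

section Solution
variable {τ γ : ℝ} {u : ℝ → EuclideanSpace ℂ (Fin 2)}

theorem memLp_coord (hu : MemLp u 2 (volume.restrict (Icc 0 τ))) (j : Fin 2) :
    MemLp (fun σ => u σ j) 2 (volume.restrict (Icc 0 τ)) :=
  (EuclideanSpace.proj (𝕜 := ℂ) j).comp_memLp' hu

theorem weighted_apply (σ : ℝ) (j : Fin 2) :
    weighted τ γ u σ j = weightedScalar τ γ (fun σ => u σ j) σ := rfl

/-- The solution for the weighted input `u_γ`. -/
def solution (τ γ : ℝ) (u : ℝ → EuclideanSpace ℂ (Fin 2)) (t : ℝ) : WNeg :=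
  inputState τ γ (fun σ => u σ 0) t + (inputState τ γ (fun σ => u σ 1) t).comp reflect

theorem integrableOn_weighted (hτ : 0 < τ) (hγ : 0 ≤ γ) (hγ4 : γ < 1 / 4)
    (hu : MemLp u 2 (volume.restrict (Icc 0 τ))) : IntegrableOn (weighted τ γ u) (Icc 0 τ) := by
  have hn : MemLp (fun σ => ((‖u σ‖ : ℝ) : ℂ)) 2 (volume.restrict (Icc 0 τ)) :=
    hu.norm.ofReal
  refine Integrable.mono (integrableOn_weightedScalar hτ hγ (by linarith) hn) ?_ ?_
  · have hm : AEStronglyMeasurable (fun σ : ℝ => (((τ - σ) ^ (-γ) : ℝ) : ℂ))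
        (volume.restrict (Icc 0 τ)) := Measurable.aestronglyMeasurable (by fun_prop)
    exact hm.smul hu.aestronglyMeasurable
  · refine Filter.Eventually.of_forall fun σ => le_of_eq ?_
    rw [weighted, weightedScalar, norm_smul, norm_mul, norm_real, norm_real, norm_norm]

theorem isSolution_solution (hτ : 0 < τ) (hγ : 0 ≤ γ) (hγ4 : γ < 1 / 4)
    (hu : MemLp u 2 (volume.restrict (Icc 0 τ))) :
    IsSolution τ (weighted τ γ u) (solution τ γ u) where
  integrable := integrableOn_weighted hτ hγ hγ4 hu
  continuousOn := (continuousOn_inputState hτ hγ hγ4 (memLp_coord hu 0)).add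
    ((continuousOn_inputState hτ hγ hγ4 (memLp_coord hu 1)).clm_comp continuousOn_const)
  initial := by simp [solution, inputState]
  equation := by
    intro φ ψ h t ht
    have h0 := inputState_equation hτ hγ hγ4 (memLp_coord hu 0) h ht
    have h1 := inputState_equation hτ hγ hγ4 (memLp_coord hu 1) (reflect_deriv_deriv h) ht
    have hst : ∀ (j : Fin 2) (χ : Test),
        IntervalIntegrable (fun σ => inputState τ γ (fun σ => u σ j) σ χ) volume 0 t := by
      intro j χ
      refine ContinuousOn.intervalIntegrable ?_
      rw [uIcc_of_le ht.1]
      exact ((continuousOn_inputState hτ hγ hγ4 (memLp_coord hu j)).mono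
        (Icc_subset_Icc_right ht.2)).clm_apply continuousOn_const
    have hv := fun j => intervalIntegrable_weightedScalar hτ hγ hγ4 (memLp_coord hu j) ht
    rw [solution, add_apply, ContinuousLinearMap.comp_apply, h0, h1,
      ← intervalIntegral.integral_add ((hst 0 _).add ((hv 0).mul_const _))
        ((hst 1 _).add ((hv 1).mul_const _))]
    refine intervalIntegral.integral_congr fun σ _ => ?_
    simp only [solution, add_apply, ContinuousLinearMap.comp_apply, weighted_apply,
      deriv_reflect, sub_zero]
    ring

end Solution

/-! ### Uniqueness of solutions -/

/-- The eigenfunction `sin(nx)` as a test function. -/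
def sinTest (n : ℤ) : Test :=
  ⟨fun x => sin (n * x), (Complex.contDiff_sin.restrict_scalars ℝ).comp
    (contDiff_const.mul ofRealCLM.contDiff), by simp, Complex.sin_int_mul_pi n⟩

theorem deriv_sinTest (n : ℤ) (x : ℝ) : deriv (sinTest n : ℝ → ℂ) x = n * cos (n * x) :=
  (hasDerivAt_sin_int_mul n x).deriv

theorem deriv_deriv_sinTest (n : ℤ) (x : ℝ) :
    (-(n : ℂ) ^ 2 • sinTest n : Test) x = deriv (deriv (sinTest n)) x := by
  have h : deriv (sinTest n : ℝ → ℂ) = fun x : ℝ => n * cos (n * x) := funext (deriv_sinTest n)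
  rw [h, ((hasDerivAt_cos_int_mul n x).const_mul (n : ℂ)).deriv]
  change -(n : ℂ) ^ 2 * sin (n * x) = _
  ring

/-- The sines span a dense space of test functions: the partial sums of the cosine series of `φ'`,
integrated termwise, converge to `φ`. -/
theorem eq_zero_of_forall_sinTest {ℓ : WNeg} (h : ∀ n, ℓ (sinTest n) = 0) : ℓ = 0 := by
  ext φ
  have hpi := Real.pi_pos
  have hpc : (Real.pi : ℂ) ≠ 0 := ofReal_ne_zero.2 hpi.ne'
  set g : ℤ → ℝ := fun n => 1 / Real.pi * ‖cosCoeff n φ‖ with hg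
  have hgs : Summable g := (summable_norm_cosCoeff φ).mul_left _
  set S : Finset ℤ → Test := fun F => ∑ n ∈ F, (cosCoeff n φ / (Real.pi * n)) • sinTest n with hS
  have hℓS : ∀ F, ℓ (S F) = 0 := by
    intro F
    rw [hS]; dsimp only
    rw [map_sum]
    exact Finset.sum_eq_zero fun n _ => by rw [map_smul, h, smul_zero]
  have hb : ∀ F, ‖φ - S F‖ ≤ Real.sqrt Real.pi * (∑' n, g n - ∑ n ∈ F, g n) := by
    intro F
    refine Test.norm_le_of_forall (sub_nonneg.2 (hgs.sum_le_tsum F fun n _ => by positivity))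
      fun x hx => ?_
    have hd : deriv (φ - S F : Test) x = deriv (φ : ℝ → ℂ) x -
        ∑ n ∈ F, 1 / (Real.pi : ℂ) * cosCoeff n φ * cos (n * x) := by
      rw [← Test.derivAt_apply, map_sub, hS]
      dsimp only
      rw [map_sum]
      congr 1
      refine Finset.sum_congr rfl fun n _ => ?_
      rw [map_smul, Test.derivAt_apply, deriv_sinTest, smul_eq_mul]
      rcases eq_or_ne n 0 with rfl | hn
      · rw [cosCoeff_zero]; simp
      · have : (n : ℂ) ≠ 0 := by exact_mod_cast hn
        field_simp
    rw [hd]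
    have h1 := hasSum_cosCoeff_mul_cos φ hx
    rw [← sub_add_cancel (deriv (φ : ℝ → ℂ) x) (∑ n ∈ F, 1 / (Real.pi : ℂ) * cosCoeff n φ *
      cos (n * x)), ← Finset.hasSum_compl_iff] at h1
    have h2 := hgs.hasSum
    rw [← sub_add_cancel (∑' n, g n) (∑ n ∈ F, g n), ← Finset.hasSum_compl_iff] at h2
    refine h1.norm_le_of_bounded h2 fun n => ?_
    simp only [hg]
    rw [norm_mul, norm_mul, norm_div, norm_one, norm_real, Real.norm_of_nonneg hpi.le]
    refine mul_le_of_le_one_right (by positivity) ?_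
    rw [← ofReal_intCast, ← ofReal_mul, ← ofReal_cos, norm_real]
    exact Real.abs_cos_le_one _
  have hlim : Filter.Tendsto (fun F : Finset ℤ => ‖ℓ‖ * (Real.sqrt Real.pi *
      (∑' n, g n - ∑ n ∈ F, g n))) Filter.atTop (nhds 0) := by
    have h1 : Filter.Tendsto (fun F : Finset ℤ => ∑ n ∈ F, g n) Filter.atTop
      (nhds (∑' n, g n)) := hgs.hasSum
    have := ((h1.const_sub (∑' n, g n)).const_mul (Real.sqrt Real.pi)).const_mul ‖ℓ‖
    simpa using this
  rw [zero_apply, ← norm_le_zero_iff]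
  refine ge_of_tendsto' hlim fun F => ?_
  have : ℓ φ = ℓ (φ - S F) := by rw [map_sub, hℓS, sub_zero]
  rw [this]
  exact (ℓ.le_opNorm _).trans (mul_le_mul_of_nonneg_left (hb F) (norm_nonneg _))

theorem eq_zero_of_eq_integral {τ : ℝ} (hτ : 0 ≤ τ) {a : ℝ → ℂ} (c : ℂ)
    (hc : ContinuousOn a (Icc 0 τ)) (h : ∀ t ∈ Icc 0 τ, a t = ∫ s in (0 : ℝ)..t, c * a s) :
    ∀ t ∈ Icc 0 τ, a t = 0 := by
  set b : ℝ → ℂ := IccExtend hτ (fun s : Icc 0 τ => a s) with hb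
  have hbc : Continuous b := by
    rw [hb, continuous_IccExtend_iff]
    exact continuousOn_iff_continuous_domRestrict.1 hc
  have hba : ∀ s ∈ Icc 0 τ, b s = a s := fun s hs => by
    rw [hb, IccExtend_of_mem hτ _ hs]
  set F : ℝ → ℂ := fun t => ∫ s in (0 : ℝ)..t, c * b s with hF
  have hFa : ∀ t ∈ Icc 0 τ, F t = a t := by
    intro t ht
    rw [h t ht]
    refine intervalIntegral.integral_congr fun s hs => ?_
    rw [uIcc_of_le ht.1] at hs
    rw [hba s ⟨hs.1, hs.2.trans ht.2⟩]
  have hcb : Continuous fun s => c * b s := continuous_const.mul hbc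
  have hFd : ∀ t, HasDerivAt F (c * b t) t := fun t =>
    intervalIntegral.integral_hasDerivAt_right (hcb.intervalIntegrable _ _)
      (hcb.stronglyMeasurableAtFilter _ _) hcb.continuousAt
  have hgr := norm_le_gronwallBound_of_norm_deriv_right_le (f := F) (f' := fun t => c * b t)
    (δ := 0) (K := ‖c‖) (ε := 0) (a := 0) (b := τ)
    (fun t _ => (hFd t).continuousAt.continuousWithinAt)
    (fun t _ => (hFd t).hasDerivWithinAt) (by simp [hF]) (fun t ht => by
      rw [norm_mul, hba t (Ico_subset_Icc_self ht), hFa t (Ico_subset_Icc_self ht), add_zero])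
  intro t ht
  have := hgr t ht
  rw [gronwallBound_ε0_δ0, norm_le_zero_iff, hFa t ht] at this
  exact this

theorem IsSolution.eqOn {τ : ℝ} (hτ : 0 ≤ τ) {u : ℝ → EuclideanSpace ℂ (Fin 2)}
    {z₁ z₂ : ℝ → WNeg} (h₁ : IsSolution τ u z₁) (h₂ : IsSolution τ u z₂) :
    EqOn z₁ z₂ (Icc 0 τ) := by
  have key : ∀ n : ℤ, ∀ t ∈ Icc 0 τ, (z₁ t - z₂ t) (sinTest n) = 0 := by
    intro n
    refine eq_zero_of_eq_integral hτ (-(n : ℂ) ^ 2)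
      ((h₁.continuousOn.sub h₂.continuousOn).clm_apply continuousOn_const) fun t ht => ?_
    have hsub : Icc 0 t ⊆ Icc 0 τ := Icc_subset_Icc_right ht.2
    have hu : IntervalIntegrable u volume 0 t := by
      rw [intervalIntegrable_iff_integrableOn_Icc_of_le ht.1]
      exact h₁.integrable.mono_set hsub
    have huj : ∀ j : Fin 2, IntervalIntegrable (fun σ => u σ j) volume 0 t := fun j =>
      ⟨(EuclideanSpace.proj (𝕜 := ℂ) j).integrable_comp hu.1,
        (EuclideanSpace.proj (𝕜 := ℂ) j).integrable_comp hu.2⟩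
    have hz : ∀ z : ℝ → WNeg, ContinuousOn z (Icc 0 τ) → ∀ ψ : Test,
        IntervalIntegrable (fun σ => z σ ψ) volume 0 t := by
      intro z hz ψ
      refine ContinuousOn.intervalIntegrable ?_
      rw [uIcc_of_le ht.1]
      exact (hz.mono hsub).clm_apply continuousOn_const
    rw [sub_apply, h₁.equation _ _ (deriv_deriv_sinTest n) t ht,
      h₂.equation _ _ (deriv_deriv_sinTest n) t ht, ← intervalIntegral.integral_sub]
    · refine intervalIntegral.integral_congr fun σ _ => ?_
      simp only [map_smul, smul_eq_mul, sub_apply]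
      ring
    · exact ((hz z₁ h₁.continuousOn _).add ((huj 0).mul_const _)).sub ((huj 1).mul_const _)
    · exact ((hz z₂ h₂.continuousOn _).add ((huj 0).mul_const _)).sub ((huj 1).mul_const _)
  intro t ht
  exact sub_eq_zero.1 (eq_zero_of_forall_sinTest fun n => key n t ht)

theorem IsSolution.inputMap_eq {τ : ℝ} (hτ : 0 ≤ τ) {u : ℝ → EuclideanSpace ℂ (Fin 2)}
    {z : ℝ → WNeg} (h : IsSolution τ u z) : inputMap τ u = z τ := by
  have hex : ∃ z, IsSolution τ u z := ⟨z, h⟩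
  rw [inputMap, dif_pos hex]
  exact hex.choose_spec.eqOn hτ h ⟨hτ, le_rfl⟩

/-! ### The rhombus and the weighted area measure -/

/-- The standing assumptions on the parameters. -/
structure Admissible (τ δ Θ γ : ℝ) : Prop where
  pos : 0 < τ
  delta : δ ∈ Ioo (0 : ℝ) 1
  theta : Θ ∈ Ioo (0 : ℝ) (Real.pi / 4)
  gamma : γ ∈ Ico (0 : ℝ) (δ / 4)

theorem Admissible.gamma_lt {τ δ Θ γ : ℝ} (h : Admissible τ δ Θ γ) : γ < 1 / 4 := by
  linarith [h.gamma.2, h.delta.2]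

theorem Admissible.tan_pos {τ δ Θ γ : ℝ} (h : Admissible τ δ Θ γ) : 0 < Real.tan Θ :=
  Real.tan_pos_of_pos_of_lt_pi_div_two h.theta.1 (by linarith [h.theta.2, Real.pi_pos])

theorem Admissible.tan_lt_one {τ δ Θ γ : ℝ} (h : Admissible τ δ Θ γ) : Real.tan Θ < 1 := by
  rw [← Real.tan_pi_div_four]
  exact Real.tan_lt_tan_of_lt_of_lt_pi_div_two (by linarith [h.theta.1, Real.pi_pos])
    (by linarith [Real.pi_pos]) h.theta.2

theorem isOpen_rhombus (Θ : ℝ) : IsOpen (rhombus Θ) := by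
  have h1 : IsOpen {s : ℂ | |s.im| < Real.tan Θ * s.re} := isOpen_lt (by fun_prop) (by fun_prop)
  have h2 : IsOpen {s : ℂ | |s.im| < Real.tan Θ * (Real.pi - s.re)} :=
    isOpen_lt (by fun_prop) (by fun_prop)
  exact h1.inter h2

theorem pi_sub_mem_rhombus {Θ : ℝ} {s : ℂ} : (Real.pi : ℂ) - s ∈ rhombus Θ ↔ s ∈ rhombus Θ := by
  simp only [rhombus, mem_ofPred_eq, sub_im, ofReal_im, zero_sub, abs_neg, sub_re, ofReal_re,
    sub_sub_cancel]
  exact and_comm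

theorem re_mem_Ioo_of_mem_rhombus {Θ : ℝ} (hΘ : 0 < Real.tan Θ) {s : ℂ} (hs : s ∈ rhombus Θ) :
    s.re ∈ Ioo 0 Real.pi := by
  have h1 := (abs_nonneg _).trans_lt hs.1
  have h2 := (abs_nonneg _).trans_lt hs.2
  exact ⟨pos_of_mul_pos_right h1 hΘ.le, sub_pos.1 (pos_of_mul_pos_right h2 hΘ.le)⟩

theorem ofReal_mem_rhombus {Θ : ℝ} (hΘ : 0 < Real.tan Θ) {x : ℝ} (hx : x ∈ Ioo 0 Real.pi) :
    (x : ℂ) ∈ rhombus Θ := by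
  simp only [rhombus, mem_ofPred_eq, ofReal_im, abs_zero, ofReal_re]
  exact ⟨mul_pos hΘ hx.1, mul_pos hΘ (sub_pos.2 hx.2)⟩

theorem ae_mem_rhombus (δ Θ : ℝ) : ∀ᵐ s ∂bergmanMeasure δ Θ, s ∈ rhombus Θ :=
  (withDensity_absolutelyContinuous _ _).ae_le (ae_restrict_mem (isOpen_rhombus Θ).measurableSet)

theorem lintegral_bergmanMeasure (δ Θ : ℝ) {f : ℂ → ℝ≥0∞} (hf : Measurable f) :
    ∫⁻ s, f s ∂bergmanMeasure δ Θ = ∫⁻ s in rhombus Θ,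
      ENNReal.ofReal (‖s‖ ^ δ * ‖(Real.pi : ℂ) - s‖ ^ δ) * f s := by
  rw [bergmanMeasure, lintegral_withDensity_eq_lintegral_mul _ (by fun_prop) hf]
  rfl

theorem lintegral_bergmanMeasure_pi_sub (δ Θ : ℝ) {f : ℂ → ℝ≥0∞} (hf : Measurable f) :
    ∫⁻ s, f (Real.pi - s) ∂bergmanMeasure δ Θ = ∫⁻ s, f s ∂bergmanMeasure δ Θ := by
  rw [lintegral_bergmanMeasure δ Θ hf,
    lintegral_bergmanMeasure δ Θ (f := fun s => f (Real.pi - s)) (hf.comp (by fun_prop)),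
    ← lintegral_indicator (isOpen_rhombus Θ).measurableSet,
    ← lintegral_indicator (isOpen_rhombus Θ).measurableSet,
    ← lintegral_sub_left_eq_self (μ := volume) ((rhombus Θ).indicator _) (Real.pi : ℂ)]
  congr 1
  funext s
  by_cases hs : s ∈ rhombus Θ
  · rw [indicator_of_mem hs, indicator_of_mem (pi_sub_mem_rhombus.2 hs), sub_sub_cancel, mul_comm
      (‖s‖ ^ δ)]
  · rw [indicator_of_notMem hs, indicator_of_notMem (fun h => hs (pi_sub_mem_rhombus.1 h))]

/-- Integrating over `Im s` costs one power of `Re s`, hence the exponent `a + 1`. -/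
theorem lintegral_re_rpow_sector_ne_top {a : ℝ} (ha : -1 < a + 1) :
    ∫⁻ s in {s : ℂ | s.re ∈ Ioo 0 Real.pi ∧ |s.im| < s.re}, ENNReal.ofReal (s.re ^ a) ≠ ⊤ := by
  have hA : MeasurableSet {p : ℝ × ℝ | p.1 ∈ Ioo 0 Real.pi ∧ |p.2| < p.1} := by
    have hA' : MeasurableSet {p : ℝ × ℝ | |p.2| < p.1} :=
      measurableSet_lt (by fun_prop) (by fun_prop)
    exact (measurableSet_Ioo.preimage measurable_fst).inter hA'
  have h1 := Complex.volume_preserving_equiv_real_prod.setLIntegral_comp_preimage hA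
    (f := fun p : ℝ × ℝ => ENNReal.ofReal (p.1 ^ a)) (by fun_prop)
  have h2 : ∫⁻ s in {s : ℂ | s.re ∈ Ioo 0 Real.pi ∧ |s.im| < s.re}, ENNReal.ofReal (s.re ^ a) =
      ∫⁻ p in {p : ℝ × ℝ | p.1 ∈ Ioo 0 Real.pi ∧ |p.2| < p.1}, ENNReal.ofReal (p.1 ^ a) := h1
  rw [h2, ← lintegral_indicator hA, Measure.volume_eq_prod, lintegral_prod _
    (Measurable.aemeasurable (Measurable.indicator (by fun_prop) hA))]
  have h3 : ∀ x : ℝ, ∫⁻ y, {p : ℝ × ℝ | p.1 ∈ Ioo 0 Real.pi ∧ |p.2| < p.1}.indicator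
      (fun p => ENNReal.ofReal (p.1 ^ a)) (x, y) =
      (Ioo 0 Real.pi).indicator (fun x => ENNReal.ofReal (2 * x ^ (a + 1))) x := by
    intro x
    by_cases hx : x ∈ Ioo 0 Real.pi
    · rw [indicator_of_mem hx]
      have h4 : ∀ y, {p : ℝ × ℝ | p.1 ∈ Ioo 0 Real.pi ∧ |p.2| < p.1}.indicator
          (fun p => ENNReal.ofReal (p.1 ^ a)) (x, y) =
          (Ioo (-x) x).indicator (fun _ => ENNReal.ofReal (x ^ a)) y := by
        intro y
        by_cases hy : |y| < x
        · rw [indicator_of_mem (show (x, y) ∈ {p : ℝ × ℝ | p.1 ∈ Ioo 0 Real.pi ∧ |p.2| < p.1}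
            from ⟨hx, hy⟩), indicator_of_mem (show y ∈ Ioo (-x) x from abs_lt.1 hy)]
        · rw [indicator_of_notMem (show (x, y) ∉ {p : ℝ × ℝ | p.1 ∈ Ioo 0 Real.pi ∧ |p.2| < p.1}
            from fun h => hy h.2), indicator_of_notMem
            (show y ∉ Ioo (-x) x from fun h => hy (abs_lt.2 h))]
      simp_rw [h4]
      rw [lintegral_indicator measurableSet_Ioo, setLIntegral_const, Real.volume_Ioo,
        ← ENNReal.ofReal_mul (Real.rpow_nonneg hx.1.le _), Real.rpow_add hx.1, Real.rpow_one]
      congr 1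
      ring
    · rw [indicator_of_notMem hx]
      have h4 : ∀ y, {p : ℝ × ℝ | p.1 ∈ Ioo 0 Real.pi ∧ |p.2| < p.1}.indicator
          (fun p => ENNReal.ofReal (p.1 ^ a)) (x, y) = 0 := fun y =>
        indicator_of_notMem (fun h => hx h.1) _
      simp_rw [h4, lintegral_zero]
  simp_rw [h3]
  rw [lintegral_indicator measurableSet_Ioo]
  have h5 : IntegrableOn (fun x : ℝ => 2 * x ^ (a + 1)) (Ioo 0 Real.pi) :=
    (intervalIntegrable_iff_integrableOn_Ioo_of_le Real.pi_pos.le).1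
      ((intervalIntegral.intervalIntegrable_rpow' ha).const_mul 2)
  exact h5.lintegral_lt_top.ne

theorem lintegral_re_rpow_bergmanMeasure_ne_top {δ Θ m : ℝ} (hδ : 0 < δ) (hΘ : 0 < Real.tan Θ)
    (hΘ1 : Real.tan Θ < 1) (hm : 2 * m < 2 + δ) :
    ∫⁻ s, ENNReal.ofReal (s.re ^ (-(2 * m))) ∂bergmanMeasure δ Θ ≠ ⊤ := by
  have hpi := Real.pi_pos
  rw [lintegral_bergmanMeasure δ Θ (by fun_prop)]
  set c : ℝ := 2 ^ δ * (2 * Real.pi) ^ δ with hc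
  refine ne_top_of_le_ne_top (ENNReal.mul_ne_top (ENNReal.ofReal_ne_top (r := c))
    (lintegral_re_rpow_sector_ne_top (a := δ - 2 * m) (by linarith))) ?_
  have hsub : rhombus Θ ⊆ {s : ℂ | s.re ∈ Ioo 0 Real.pi ∧ |s.im| < s.re} := fun s hs => by
    have h1 := re_mem_Ioo_of_mem_rhombus hΘ hs
    refine ⟨h1, hs.1.trans_le ?_⟩
    exact mul_le_of_le_one_left h1.1.le hΘ1.le
  rw [← lintegral_const_mul _ (by fun_prop)]
  refine le_trans ?_ (lintegral_mono_set hsub)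
  refine setLIntegral_mono (by fun_prop) fun s hs => ?_
  obtain ⟨⟨h0, h1⟩, h2⟩ := hsub hs
  have h3 := (re_mem_Ioo_of_mem_rhombus hΘ hs).2
  rw [← ENNReal.ofReal_mul (by positivity), ← ENNReal.ofReal_mul (by positivity)]
  refine ENNReal.ofReal_le_ofReal ?_
  have n1 : ‖s‖ ≤ 2 * s.re := by
    refine (Complex.norm_le_abs_re_add_abs_im s).trans ?_
    rw [abs_of_pos h0]; linarith
  have n2 : ‖(Real.pi : ℂ) - s‖ ≤ 2 * Real.pi := by
    refine (Complex.norm_le_abs_re_add_abs_im _).trans ?_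
    simp only [sub_re, ofReal_re, sub_im, ofReal_im, zero_sub, abs_neg]
    rw [abs_of_pos (by linarith)]; linarith
  have e : s.re ^ (δ - 2 * m) = s.re ^ δ * s.re ^ (-(2 * m)) := by
    rw [sub_eq_add_neg, Real.rpow_add h0]
  calc _ ≤ ((2 * s.re) ^ δ * (2 * Real.pi) ^ δ) * s.re ^ (-(2 * m)) := by gcongr
    _ = _ := by
      rw [e, Real.mul_rpow zero_le_two h0.le, hc]; ring

/-! ### The kernel of the weighted input map -/

/-- The kernel `(τ - σ)^{-γ} K(τ - σ, s)` which maps the unweighted input at the endpoint `0` to the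
final state. It vanishes for `σ ≥ τ`. -/
def inputKernel (τ γ : ℝ) (s : ℂ) (σ : ℝ) : ℂ :=
  (((τ - σ) ^ (-γ) : ℝ) : ℂ) * poissonKernel (τ - σ) s

theorem measurable_inputKernel (τ γ : ℝ) :
    Measurable fun p : ℝ × ℂ => inputKernel τ γ p.2 p.1 := by
  refine Measurable.mul (by fun_prop) ?_
  exact measurable_poissonKernel.comp (f := fun p : ℝ × ℂ => (τ - p.1, p.2)) (by fun_prop)

theorem differentiable_inputKernel (τ γ σ : ℝ) :
    Differentiable ℂ fun s => inputKernel τ γ s σ :=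
  (differentiable_poissonKernel _).const_mul _

/-- The kernel is bounded by a product of powers with square integrable factors: `2 * ν < 1` in
time, and `2 * m < 2 + δ` in the plane with the weight `|s|^δ`. -/
theorem Admissible.exists_norm_inputKernel_le {τ δ Θ γ : ℝ} (h : Admissible τ δ Θ γ) :
    ∃ ν m C : ℝ, ν < 1 / 2 ∧ 0 ≤ m ∧ 2 * m < 2 + δ ∧ 0 ≤ C ∧ ∀ s ∈ rhombus Θ, ∀ σ ≤ τ,
      ‖inputKernel τ γ s σ‖ ≤ C * (τ - σ) ^ (-ν) * s.re ^ (-m) := by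
  have hγ := h.gamma
  have hδ := h.delta
  -- the conditions on `ν` and `m` read `p > 2 + 2 * γ` and `p < 2 + δ / 2`; this `p` is the midpoint
  obtain ⟨C, hC, hb⟩ := exists_norm_poissonKernel_le (p := 2 + γ + δ / 4) h.tan_pos.le h.tan_lt_one
    (by linarith [hγ.1, hδ.1])
  refine ⟨1 / 2 - δ / 8 + γ / 2, 1 + γ + δ / 4, C, by linarith [hγ.2], by linarith [hγ.1, hδ.1],
    by linarith [hγ.2], hC, fun s hs σ hσ => ?_⟩
  have hre := re_mem_Ioo_of_mem_rhombus h.tan_pos hs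
  rcases hσ.eq_or_lt with rfl | hσ
  · rw [inputKernel, sub_self, poissonKernel_of_nonpos le_rfl, mul_zero, norm_zero]
    have := Real.rpow_nonneg hre.1.le (-(1 + γ + δ / 4))
    positivity
  · have hr : 0 < τ - σ := sub_pos.2 hσ
    rw [inputKernel, norm_mul, norm_real, Real.norm_of_nonneg (by positivity)]
    refine (mul_le_mul_of_nonneg_left (hb _ hr s hre.1 hre.2 hs.1.le) (by positivity)).trans
      (le_of_eq ?_)
    rw [show -(1 / 2 - δ / 8 + γ / 2) = -γ + (2 + γ + δ / 4 - 3) / 2 by ring, Real.rpow_add hr,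
      show -(1 + γ + δ / 4) = 1 - (2 + γ + δ / 4) by ring]
    ring

theorem measurable_inputKernel_left (τ γ : ℝ) (s : ℂ) : Measurable (inputKernel τ γ s) :=
  (measurable_inputKernel τ γ).comp (f := fun σ : ℝ => (σ, s)) (by fun_prop)

/-- The kernel is square integrable over `(0, τ)` times the rhombus. A measurable majorant `B` of the
inner integral is produced, so that no measurability of that integral in `s` is needed. -/
theorem Admissible.exists_kernel_bound {τ δ Θ γ : ℝ} (h : Admissible τ δ Θ γ) :
    ∃ B : ℂ → ℝ≥0∞, Measurable B ∧ ∫⁻ s, B s ∂bergmanMeasure δ Θ ≠ ⊤ ∧ ∀ s ∈ rhombus Θ,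
      B s ≠ ⊤ ∧ ∫⁻ σ in Icc 0 τ, (‖inputKernel τ γ s σ‖ₑ ^ 2 +
        ‖inputKernel τ γ (Real.pi - s) σ‖ₑ ^ 2) ≤ B s := by
  obtain ⟨ν, m, C, hν, hm0, hm, hC, hb⟩ := h.exists_norm_inputKernel_le
  set Tc : ℝ≥0∞ := ∫⁻ σ in Icc 0 τ, ENNReal.ofReal (C ^ 2 * (τ - σ) ^ (-(2 * ν))) with hTc
  have hTfin : Tc ≠ ⊤ := by
    have h1 := (intervalIntegral.intervalIntegrable_rpow' (a := 0) (b := τ)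
      (show -1 < -(2 * ν) by linarith)).comp_sub_left τ
    simp only [sub_zero, sub_self] at h1
    have h2 := (intervalIntegrable_iff_integrableOn_Icc_of_le h.pos.le).1
      (h1.symm.const_mul (C ^ 2))
    exact h2.lintegral_lt_top.ne
  set f : ℂ → ℝ≥0∞ := fun s => Tc * ENNReal.ofReal (s.re ^ (-(2 * m))) with hf
  have hfm : Measurable f := by rw [hf]; fun_prop
  have hfint : ∫⁻ s, f s ∂bergmanMeasure δ Θ ≠ ⊤ := by
    rw [hf, lintegral_const_mul _ (by fun_prop)]
    exact ENNReal.mul_ne_top hTfin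
      (lintegral_re_rpow_bergmanMeasure_ne_top h.delta.1 h.tan_pos h.tan_lt_one hm)
  have hfk : ∀ s ∈ rhombus Θ, ∫⁻ σ in Icc 0 τ, ‖inputKernel τ γ s σ‖ₑ ^ 2 ≤ f s := by
    intro s hs
    have hre := re_mem_Ioo_of_mem_rhombus h.tan_pos hs
    rw [hf, hTc]
    dsimp only
    rw [← lintegral_mul_const _ (by fun_prop)]
    refine setLIntegral_mono (by fun_prop) fun σ hσ => ?_
    have hr : 0 ≤ τ - σ := sub_nonneg.2 hσ.2
    rw [enorm_sq_eq_ofReal, ← ENNReal.ofReal_mul (by positivity)]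
    refine ENNReal.ofReal_le_ofReal ?_
    refine (pow_le_pow_left₀ (norm_nonneg _) (hb s hs σ hσ.2) 2).trans (le_of_eq ?_)
    have e1 : (τ - σ) ^ (-(2 * ν)) = ((τ - σ) ^ (-ν)) ^ 2 := by
      rw [← Real.rpow_natCast, ← Real.rpow_mul hr]; congr 1; push_cast; ring
    have e2 : s.re ^ (-(2 * m)) = (s.re ^ (-m)) ^ 2 := by
      rw [← Real.rpow_natCast, ← Real.rpow_mul hre.1.le]; congr 1; push_cast; ring
    rw [e1, e2]; ring
  refine ⟨fun s => f s + f (Real.pi - s), hfm.add (hfm.comp (by fun_prop)), ?_, fun s hs => ?_⟩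
  · rw [lintegral_add_left hfm, lintegral_bergmanMeasure_pi_sub δ Θ hfm]
    exact ENNReal.add_ne_top.2 ⟨hfint, hfint⟩
  · refine ⟨ENNReal.add_ne_top.2 ⟨ENNReal.mul_ne_top hTfin ENNReal.ofReal_ne_top,
      ENNReal.mul_ne_top hTfin ENNReal.ofReal_ne_top⟩, ?_⟩
    rw [lintegral_add_left ((measurable_inputKernel_left τ γ s).enorm.pow_const 2)]
    exact add_le_add (hfk s hs) (hfk _ (pi_sub_mem_rhombus.2 hs))

/-! ### The final state as a holomorphic function -/

/-- The final state, at the complex point `s`, for the input `w` at the endpoint `0`. -/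
def output (τ γ : ℝ) (w : ℝ → ℂ) (s : ℂ) : ℂ := ∫ σ in (0 : ℝ)..τ, inputKernel τ γ s σ * w σ

theorem Admissible.differentiableOn_output {τ δ Θ γ : ℝ} (h : Admissible τ δ Θ γ) {w : ℝ → ℂ}
    (hw : MemLp w 2 (volume.restrict (Icc 0 τ))) :
    DifferentiableOn ℂ (output τ γ w) (rhombus Θ) := by
  obtain ⟨ν, m, C, hν, hm0, hm, hC, hb⟩ := h.exists_norm_inputKernel_le
  obtain ⟨M, _, hM⟩ := exists_integral_norm_mul_rpow_le h.pos hν hw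
  have hint := (hM τ ⟨h.pos.le, le_rfl⟩).1
  intro s₀ hs₀
  obtain ⟨R, hR, hRsub⟩ := Metric.isOpen_iff.1 (isOpen_rhombus Θ) s₀ hs₀
  have hre₀ := re_mem_Ioo_of_mem_rhombus h.tan_pos hs₀
  -- on the disc of radius `2ρ` around `s₀` the real part stays above `s₀.re / 2`
  set ρ := min (R / 4) (s₀.re / 4) with hρ
  have hρ0 : 0 < ρ := lt_min (by linarith) (by linarith [hre₀.1])
  have hball : ∀ s ∈ Metric.ball s₀ ρ, ∀ z ∈ Metric.sphere s ρ, z ∈ rhombus Θ ∧ s₀.re / 2 ≤ z.re := by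
    intro s hs z hz
    have hd : dist z s₀ < 2 * ρ := by
      have := dist_triangle z s s₀
      rw [Metric.mem_sphere.1 hz] at this
      linarith [Metric.mem_ball.1 hs]
    have hρR : ρ ≤ R / 4 := min_le_left _ _
    have hρs : ρ ≤ s₀.re / 4 := min_le_right _ _
    refine ⟨hRsub (Metric.mem_ball.2 (by linarith)), ?_⟩
    have h1 := (Complex.abs_re_le_norm (z - s₀)).trans_lt (by rwa [← dist_eq_norm])
    rw [sub_re] at h1
    linarith [(abs_lt.1 h1).1]
  have hmeas : ∀ s, AEStronglyMeasurable (fun σ => inputKernel τ γ s σ * w σ)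
      (volume.restrict (uIoc 0 τ)) := by
    intro s
    rw [uIoc_of_le h.pos.le, restrict_Ioc_eq_restrict_Icc]
    exact (measurable_inputKernel_left τ γ s).aestronglyMeasurable.mul hw.aestronglyMeasurable
  -- measurability of the derivative in `σ`, as a pointwise limit of difference quotients
  have hderivm : Measurable fun σ => deriv (fun s => inputKernel τ γ s σ) s₀ := by
    refine measurable_of_tendsto_metrizable (f := fun (n : ℕ) σ => ((1 / ((n : ℝ) + 1) : ℝ) : ℂ)⁻¹ *
      (inputKernel τ γ (s₀ + ((1 / ((n : ℝ) + 1) : ℝ) : ℂ)) σ - inputKernel τ γ s₀ σ))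
      (fun n => ?_) ?_
    · exact ((measurable_inputKernel_left τ γ _).sub
        (measurable_inputKernel_left τ γ _)).const_mul _
    · rw [tendsto_pi_nhds]
      intro σ
      have hd := (differentiable_inputKernel τ γ σ s₀).hasDerivAt
      rw [hasDerivAt_iff_tendsto_slope_zero] at hd
      refine hd.comp (tendsto_nhdsWithin_iff.2 ⟨?_, Filter.Eventually.of_forall fun n => ?_⟩)
      · have := (Complex.continuous_ofReal.tendsto 0).comp
          (tendsto_one_div_add_atTop_nhds_zero_nat (𝕜 := ℝ))
        rwa [ofReal_zero] at this
      · have : (0 : ℝ) < 1 / ((n : ℝ) + 1) := by positivity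
        simpa using (ofReal_ne_zero.2 this.ne')
  refine DifferentiableAt.differentiableWithinAt ?_
  have hK := intervalIntegral.hasDerivAt_integral_of_dominated_loc_of_deriv_le
    (μ := volume) (a := 0) (b := τ) (x₀ := s₀) (s := Metric.ball s₀ ρ)
    (F := fun s σ => inputKernel τ γ s σ * w σ)
    (F' := fun s σ => deriv (fun s => inputKernel τ γ s σ) s * w σ)
    (bound := fun σ => C * (s₀.re / 2) ^ (-m) / ρ * (‖w σ‖ * (τ - σ) ^ (-ν)))
    (Metric.ball_mem_nhds _ hρ0) (Filter.Eventually.of_forall hmeas) ?_ ?_ ?_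
    (hint.const_mul _) ?_
  · exact hK.2.differentiableAt
  · refine (hint.const_mul (C * s₀.re ^ (-m))).mono_fun' (hmeas s₀) ?_
    rw [uIoc_of_le h.pos.le]
    refine (ae_restrict_iff' measurableSet_Ioc).2 (Filter.Eventually.of_forall fun σ hσ => ?_)
    dsimp only
    rw [norm_mul]
    refine (mul_le_mul_of_nonneg_right (hb s₀ hs₀ σ hσ.2) (norm_nonneg _)).trans (le_of_eq ?_)
    ring
  · rw [uIoc_of_le h.pos.le, restrict_Ioc_eq_restrict_Icc]
    exact hderivm.aestronglyMeasurable.mul hw.aestronglyMeasurable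
  · refine Filter.Eventually.of_forall fun σ hσ s hs => ?_
    rw [uIoc_of_le h.pos.le] at hσ
    have hr : 0 ≤ τ - σ := sub_nonneg.2 hσ.2
    have hcauchy := Complex.norm_deriv_le_of_forall_mem_sphere_norm_le hρ0
      (f := fun s => inputKernel τ γ s σ) (c := s)
      (differentiable_inputKernel τ γ σ).diffContOnCl
      (C := C * (τ - σ) ^ (-ν) * (s₀.re / 2) ^ (-m)) fun z hz => by
        obtain ⟨hz1, hz2⟩ := hball s hs z hz
        refine (hb z hz1 σ hσ.2).trans ?_
        have := Real.rpow_le_rpow_of_nonpos (half_pos hre₀.1) hz2 (neg_nonpos.2 hm0)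
        gcongr
    rw [norm_mul]
    refine (mul_le_mul_of_nonneg_right hcauchy (norm_nonneg _)).trans (le_of_eq ?_)
    ring
  · refine Filter.Eventually.of_forall fun σ _ s _ => ?_
    exact (differentiable_inputKernel τ γ σ s).hasDerivAt.mul_const _

/-- Fubini's theorem for the final state. Test functions that vanish near `0` avoid the singularity
of the kernel there. -/
theorem Admissible.inputState_eq_integral_output {τ δ Θ γ : ℝ} (h : Admissible τ δ Θ γ)
    {w : ℝ → ℂ} (hw : MemLp w 2 (volume.restrict (Icc 0 τ))) {φ : Test} {a : ℝ} (ha : 0 < a)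
    (hφ : ∀ x ∈ Ioo 0 a, φ x = 0) :
    IntervalIntegrable (fun x : ℝ => output τ γ w x * φ x) volume 0 Real.pi ∧
      inputState τ γ w τ φ = ∫ x in (0 : ℝ)..Real.pi, output τ γ w x * φ x := by
  obtain ⟨ν, m, C, hν, hm0, hm, hC, hb⟩ := h.exists_norm_inputKernel_le
  obtain ⟨M, _, hM⟩ := exists_integral_norm_mul_rpow_le h.pos hν hw
  have hpi := Real.pi_pos
  have hτ := h.pos
  have hint := (hM τ ⟨h.pos.le, le_rfl⟩).1
  rw [intervalIntegrable_iff_integrableOn_Ioo_of_le hτ.le] at hint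
  have hφc : Continuous (φ : ℝ → ℂ) := φ.contDiff.continuous
  have hφi : IntegrableOn (fun x => C * a ^ (-m) * ‖φ x‖) (Ioo 0 Real.pi) :=
    (Continuous.integrableOn_Icc (by fun_prop)).mono_set Ioo_subset_Icc_self
  have hprod := hint.mul_prod hφi
  have hwm : AEStronglyMeasurable w (volume.restrict (Ioo 0 τ)) :=
    hw.aestronglyMeasurable.mono_measure (Measure.restrict_mono Ioo_subset_Icc_self le_rfl)
  have hF : Integrable (Function.uncurry fun σ x : ℝ => inputKernel τ γ x σ * w σ * φ x)
      ((volume.restrict (Ioo 0 τ)).prod (volume.restrict (Ioo 0 Real.pi))) := by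
    refine hprod.mono' ?_ ?_
    · refine (AEStronglyMeasurable.mul ?_ hwm.comp_fst).mul ?_
      · exact ((measurable_inputKernel τ γ).comp
          (f := fun p : ℝ × ℝ => (p.1, (p.2 : ℂ))) (by fun_prop)).aestronglyMeasurable
      · exact Continuous.aestronglyMeasurable (by fun_prop)
    · rw [Measure.prod_restrict]
      refine (ae_restrict_iff' (measurableSet_Ioo.prod measurableSet_Ioo)).2
        (Filter.Eventually.of_forall fun p hp => ?_)
      obtain ⟨hσ, hx⟩ := hp
      have hr : 0 < τ - p.1 := sub_pos.2 hσ.2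
      simp only [Function.uncurry]
      rw [norm_mul, norm_mul]
      rcases lt_or_ge p.2 a with hlt | hge
      · rw [hφ p.2 ⟨hx.1, hlt⟩, norm_zero, mul_zero, mul_zero, mul_zero]
      · have h1 := hb _ (ofReal_mem_rhombus h.tan_pos hx) p.1 hσ.2.le
        rw [ofReal_re] at h1
        have h2 := Real.rpow_le_rpow_of_nonpos ha hge (neg_nonpos.2 hm0)
        calc _ ≤ (C * (τ - p.1) ^ (-ν) * a ^ (-m)) * ‖w p.1‖ * ‖φ p.2‖ := by
              gcongr
              exact h1.trans (by gcongr)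
          _ = _ := by ring
  have e1 : ∀ σ ∈ Ioo 0 τ, weightedScalar τ γ w σ * boundaryFlux (τ - σ) φ =
      ∫ x in Ioo 0 Real.pi, inputKernel τ γ x σ * w σ * φ x := by
    intro σ hσ
    rw [boundaryFlux_eq_integral_poissonKernel (sub_pos.2 hσ.2),
      intervalIntegral.integral_of_le hpi.le, integral_Ioc_eq_integral_Ioo, ← integral_const_mul]
    congr 1
    funext x
    rw [weightedScalar, inputKernel]; ring
  have e2 : ∀ x ∈ Ioo 0 Real.pi, output τ γ w x * φ x =
      ∫ σ in Ioo 0 τ, inputKernel τ γ x σ * w σ * φ x := by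
    intro x _
    rw [output, intervalIntegral.integral_of_le hτ.le, integral_Ioc_eq_integral_Ioo,
      ← integral_mul_const]
  refine ⟨?_, ?_⟩
  · rw [intervalIntegrable_iff_integrableOn_Ioo_of_le hpi.le, integrableOn_congr_fun e2
      measurableSet_Ioo]
    exact hF.integral_prod_right
  rw [inputState_apply hτ h.gamma.1 h.gamma_lt hw φ ⟨hτ.le, le_rfl⟩,
    intervalIntegral.integral_of_le hτ.le, integral_Ioc_eq_integral_Ioo,
    intervalIntegral.integral_of_le hpi.le, integral_Ioc_eq_integral_Ioo]
  rw [setIntegral_congr_fun measurableSet_Ioo e1, setIntegral_congr_fun measurableSet_Ioo e2]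
  exact integral_integral_swap hF

/-! ### The weighted input map into the Bergman space -/

theorem memLp_two_of_lintegral_ne_top {α E : Type*} [MeasurableSpace α] {μ : Measure α}
    [NormedAddCommGroup E] {f : α → E} (hf : AEStronglyMeasurable f μ)
    (h : ∫⁻ x, ‖f x‖ₑ ^ 2 ∂μ ≠ ⊤) : MemLp f 2 μ := by
  refine ⟨hf, (eLpNorm_lt_top_iff_lintegral_rpow_enorm_lt_top two_ne_zero
    ENNReal.ofNat_ne_top).2 ?_⟩
  simpa using h.lt_top

theorem summable_norm_sq_of_forall_sum_le {ι E : Type*} [SeminormedAddCommGroup E] {f : ι → E}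
    {M : ℝ≥0∞} (hM : M ≠ ⊤) (h : ∀ F : Finset ι, ∑ i ∈ F, ‖f i‖ₑ ^ 2 ≤ M) :
    Summable fun i => ‖f i‖ ^ 2 := by
  refine summable_of_sum_le (c := M.toReal) (fun _ => sq_nonneg _) fun F => ?_
  have h1 := ENNReal.toReal_mono hM (h F)
  rw [ENNReal.toReal_sum fun i _ => by simp] at h1
  simpa using h1

/-- The kernel for inputs at both endpoints. It is conjugated, so that the final state at `s` is the
inner product of `vectorKernel τ γ s` with the input. -/
def vectorKernel (τ γ : ℝ) (s : ℂ) (σ : ℝ) : EuclideanSpace ℂ (Fin 2) :=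
  !₂[(starRingEnd ℂ) (inputKernel τ γ s σ), (starRingEnd ℂ) (inputKernel τ γ (Real.pi - s) σ)]

theorem enorm_vectorKernel_sq (τ γ : ℝ) (s : ℂ) (σ : ℝ) :
    ‖vectorKernel τ γ s σ‖ₑ ^ 2 =
      ‖inputKernel τ γ s σ‖ₑ ^ 2 + ‖inputKernel τ γ (Real.pi - s) σ‖ₑ ^ 2 := by
  simp_rw [enorm_sq_eq_ofReal]
  rw [← ENNReal.ofReal_add (sq_nonneg _) (sq_nonneg _), EuclideanSpace.norm_sq_eq]
  simp [vectorKernel]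

theorem measurable_vectorKernel (τ γ : ℝ) (s : ℂ) : Measurable (vectorKernel τ γ s) := by
  refine (PiLp.continuous_toLp 2 _).measurable.comp (measurable_pi_iff.2 fun j => ?_)
  fin_cases j
  · exact continuous_conj.measurable.comp (measurable_inputKernel_left τ γ s)
  · exact continuous_conj.measurable.comp (measurable_inputKernel_left τ γ _)

/-- The final state, at the complex point `s`, for the input `u` at both endpoints. -/
def vectorOutput (τ γ : ℝ) (u : ℝ → EuclideanSpace ℂ (Fin 2)) (s : ℂ) : ℂ :=
  output τ γ (fun σ => u σ 0) s + output τ γ (fun σ => u σ 1) (Real.pi - s)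

section Output
variable {τ δ Θ γ : ℝ} {u : ℝ → EuclideanSpace ℂ (Fin 2)}

theorem Admissible.memLp_vectorKernel (h : Admissible τ δ Θ γ) {s : ℂ} (hs : s ∈ rhombus Θ) :
    MemLp (vectorKernel τ γ s) 2 (volume.restrict (Icc 0 τ)) := by
  obtain ⟨B, _, _, hB⟩ := h.exists_kernel_bound
  refine memLp_two_of_lintegral_ne_top (measurable_vectorKernel τ γ s).aestronglyMeasurable ?_
  simp_rw [enorm_vectorKernel_sq]
  exact ne_top_of_le_ne_top (hB s hs).1 (hB s hs).2

theorem Admissible.memLp_inputKernel (h : Admissible τ δ Θ γ) {s : ℂ} (hs : s ∈ rhombus Θ) :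
    MemLp (inputKernel τ γ s) 2 (volume.restrict (Icc 0 τ)) := by
  refine (h.memLp_vectorKernel hs).of_le
    (measurable_inputKernel_left τ γ s).aestronglyMeasurable
    (Filter.Eventually.of_forall fun σ => ?_)
  have := PiLp.norm_apply_le (vectorKernel τ γ s σ) 0
  simpa [vectorKernel] using this

theorem Admissible.vectorOutput_eq_inner (h : Admissible τ δ Θ γ)
    (hu : MemLp u 2 (volume.restrict (Icc 0 τ))) {s : ℂ} (hs : s ∈ rhombus Θ) :
    vectorOutput τ γ u s = inner ℂ ((h.memLp_vectorKernel hs).toLp _) (hu.toLp u) := by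
  have hi : ∀ (z : ℂ) (j : Fin 2), z ∈ rhombus Θ →
      IntegrableOn (fun σ => inputKernel τ γ z σ * u σ j) (Icc 0 τ) := fun z j hz =>
    (h.memLp_inputKernel hz).integrable_mul (memLp_coord hu j)
  rw [vectorOutput, output, output, intervalIntegral.integral_of_le h.pos.le,
    intervalIntegral.integral_of_le h.pos.le, ← integral_Icc_eq_integral_Ioc,
    ← integral_Icc_eq_integral_Ioc,
    ← integral_add (hi s 0 hs) (hi _ 1 (pi_sub_mem_rhombus.2 hs)), L2.inner_def]
  refine integral_congr_ae ?_
  filter_upwards [(h.memLp_vectorKernel hs).coeFn_toLp, hu.coeFn_toLp] with σ h1 h2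
  rw [h1, h2, PiLp.inner_apply, Fin.sum_univ_two]
  simp [vectorKernel, RCLike.inner_apply, mul_comm]

theorem Admissible.vectorOutput_coeFn_eq_inner (h : Admissible τ δ Θ γ) (u : InputSpace τ) {s : ℂ}
    (hs : s ∈ rhombus Θ) :
    vectorOutput τ γ u s = inner ℂ ((h.memLp_vectorKernel hs).toLp _) u := by
  rw [h.vectorOutput_eq_inner (Lp.memLp u) hs, Lp.toLp_coeFn]

theorem Admissible.differentiableOn_vectorOutput (h : Admissible τ δ Θ γ)
    (hu : MemLp u 2 (volume.restrict (Icc 0 τ))) :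
    DifferentiableOn ℂ (vectorOutput τ γ u) (rhombus Θ) := by
  refine (h.differentiableOn_output (memLp_coord hu 0)).add ?_
  exact (h.differentiableOn_output (memLp_coord hu 1)).comp (by fun_prop)
    fun s hs => pi_sub_mem_rhombus.2 hs

theorem Admissible.aestronglyMeasurable_vectorOutput (h : Admissible τ δ Θ γ)
    (hu : MemLp u 2 (volume.restrict (Icc 0 τ))) :
    AEStronglyMeasurable (vectorOutput τ γ u) (bergmanMeasure δ Θ) :=
  ((h.differentiableOn_vectorOutput hu).continuousOn.aestronglyMeasurable
    (isOpen_rhombus Θ).measurableSet).mono_ac (withDensity_absolutelyContinuous _ _)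

theorem Admissible.exists_lintegral_vectorOutput_le (h : Admissible τ δ Θ γ) :
    ∃ M : ℝ≥0∞, M ≠ ⊤ ∧ ∀ (u : ℝ → EuclideanSpace ℂ (Fin 2))
      (hu : MemLp u 2 (volume.restrict (Icc 0 τ))),
      ∫⁻ s, ‖vectorOutput τ γ u s‖ₑ ^ 2 ∂bergmanMeasure δ Θ ≤ M * ‖hu.toLp u‖ₑ ^ 2 := by
  obtain ⟨B, hBm, hBi, hB⟩ := h.exists_kernel_bound
  refine ⟨_, hBi, fun u hu => ?_⟩
  rw [← lintegral_mul_const _ hBm]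
  refine lintegral_mono_ae ?_
  filter_upwards [ae_mem_rhombus δ Θ] with s hs
  rw [h.vectorOutput_eq_inner hu hs]
  have hk : ‖(h.memLp_vectorKernel hs).toLp _‖ₑ ^ 2 ≤ B s := by
    rw [enorm_toLp_sq]
    simp_rw [enorm_vectorKernel_sq]
    exact (hB s hs).2
  refine le_trans ?_ (mul_le_mul_left hk _)
  rw [← mul_pow]
  refine pow_le_pow_left' ?_ 2
  simp_rw [← ofReal_norm, ← ENNReal.ofReal_mul (norm_nonneg _)]
  exact ENNReal.ofReal_le_ofReal (norm_inner_le_norm _ _)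

theorem Admissible.memLp_vectorOutput (h : Admissible τ δ Θ γ)
    (hu : MemLp u 2 (volume.restrict (Icc 0 τ))) :
    MemLp (vectorOutput τ γ u) 2 (bergmanMeasure δ Θ) := by
  obtain ⟨M, hM, hle⟩ := h.exists_lintegral_vectorOutput_le
  exact memLp_two_of_lintegral_ne_top (h.aestronglyMeasurable_vectorOutput hu)
    (ne_top_of_le_ne_top (ENNReal.mul_ne_top hM (ENNReal.pow_ne_top enorm_ne_top)) (hle u hu))

/-- The final state for the input `u` as an element of the Bergman space. -/
def bergmanOutput (h : Admissible τ δ Θ γ) (u : ℝ → EuclideanSpace ℂ (Fin 2))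
    (hu : MemLp u 2 (volume.restrict (Icc 0 τ))) : bergman δ Θ :=
  ⟨(h.memLp_vectorOutput hu).toLp _, vectorOutput τ γ u, h.differentiableOn_vectorOutput hu,
    (h.memLp_vectorOutput hu).coeFn_toLp⟩

theorem enorm_bergmanOutput_sq (h : Admissible τ δ Θ γ)
    (hu : MemLp u 2 (volume.restrict (Icc 0 τ))) :
    ‖bergmanOutput h u hu‖ₑ ^ 2 = ∫⁻ s, ‖vectorOutput τ γ u s‖ₑ ^ 2 ∂bergmanMeasure δ Θ :=
  enorm_toLp_sq (h.memLp_vectorOutput hu)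

theorem isTrace_bergmanOutput (h : Admissible τ δ Θ γ)
    (hu : MemLp u 2 (volume.restrict (Icc 0 τ))) :
    IsTrace (bergmanOutput h u hu) (inputMap τ (weighted τ γ u)) := by
  refine ⟨vectorOutput τ γ u, h.differentiableOn_vectorOutput hu,
    (h.memLp_vectorOutput hu).coeFn_toLp, fun φ hφ => ?_⟩
  have hnear : ∀ x₀ : ℝ, x₀ ∉ Ioo 0 Real.pi → ∃ a > 0, ∀ x, |x - x₀| < a → φ x = 0 := by
    intro x₀ hx₀
    obtain ⟨a, ha, hsub⟩ := Metric.isOpen_iff.1 (isClosed_tsupport (φ : ℝ → ℂ)).isOpen_compl x₀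
      fun hmem => hx₀ (hφ hmem)
    exact ⟨a, ha, fun x hx => image_eq_zero_of_notMem_tsupport (hsub hx)⟩
  obtain ⟨a, ha, hφa⟩ := hnear 0 fun h => lt_irrefl _ h.1
  obtain ⟨b, hb, hφb⟩ := hnear Real.pi fun h => lt_irrefl _ h.2
  obtain ⟨i0, e0⟩ := h.inputState_eq_integral_output (memLp_coord hu 0) ha (φ := φ)
    fun x hx => hφa x (by rw [sub_zero, abs_of_pos hx.1]; exact hx.2)
  obtain ⟨i1, e1⟩ := h.inputState_eq_integral_output (memLp_coord hu 1) hb (φ := reflect φ)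
    fun x hx => hφb _ (by rw [sub_sub_cancel_left, abs_neg, abs_of_pos hx.1]; exact hx.2)
  have i1' := i1.comp_sub_left Real.pi
  simp only [sub_zero, sub_self] at i1'
  have e2 := intervalIntegral.integral_comp_sub_left (a := 0) (b := Real.pi)
    (fun x : ℝ => output τ γ (fun σ => u σ 1) x * reflect φ x) Real.pi
  simp only [sub_zero, sub_self] at e2
  rw [(isSolution_solution h.pos h.gamma.1 h.gamma_lt hu).inputMap_eq h.pos.le, solution,
    add_apply, ContinuousLinearMap.comp_apply, e0, e1, ← e2,
    ← intervalIntegral.integral_add i0 i1'.symm]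
  refine intervalIntegral.integral_congr fun x _ => ?_
  simp only [vectorOutput, reflect_apply, sub_sub_cancel, ofReal_sub]
  ring

/-- A Bessel inequality for the functions `v i`, tested only against the kernels at the points `s`,
makes the squared norms of the final states summable, since the kernel is square integrable. -/
theorem summable_norm_bergmanOutput_sq (h : Admissible τ δ Θ γ) {ι : Type*}
    {v : ι → ℝ → EuclideanSpace ℂ (Fin 2)} (hv : ∀ i, MemLp (v i) 2 (volume.restrict (Icc 0 τ)))
    {C : ℝ≥0∞} (hC : C ≠ ⊤) (hle : ∀ s ∈ rhombus Θ, ∀ F : Finset ι,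
      ∑ i ∈ F, ‖vectorOutput τ γ (v i) s‖ₑ ^ 2 ≤
        C * ∫⁻ σ in Icc 0 τ, ‖vectorKernel τ γ s σ‖ₑ ^ 2) :
    Summable fun i => ‖bergmanOutput h (v i) (hv i)‖ ^ 2 := by
  obtain ⟨B, hBm, hBi, hB⟩ := h.exists_kernel_bound
  refine summable_norm_sq_of_forall_sum_le (ENNReal.mul_ne_top hC hBi) fun F => ?_
  simp_rw [enorm_bergmanOutput_sq]
  rw [← lintegral_finsetSum' _ fun i _ =>
      (h.aestronglyMeasurable_vectorOutput (hv i)).enorm.pow_const 2,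
    ← lintegral_const_mul _ hBm]
  refine lintegral_mono_ae ?_
  filter_upwards [ae_mem_rhombus δ Θ] with s hs
  refine (hle s hs F).trans (mul_le_mul' le_rfl ?_)
  simp_rw [enorm_vectorKernel_sq]
  exact (hB s hs).2

/-- The weighted input map as a linear map into the Bergman space. -/
def weightedInputMap (h : Admissible τ δ Θ γ) : InputSpace τ →ₗ[ℂ] bergman δ Θ where
  toFun u := bergmanOutput h u (Lp.memLp u)
  map_add' u v := by
    refine Subtype.ext ?_
    change (h.memLp_vectorOutput (Lp.memLp (u + v))).toLp _ =
      (h.memLp_vectorOutput (Lp.memLp u)).toLp _ + (h.memLp_vectorOutput (Lp.memLp v)).toLp _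
    rw [← MemLp.toLp_add]
    refine MemLp.toLp_congr _ _ ?_
    filter_upwards [ae_mem_rhombus δ Θ] with s hs
    rw [Pi.add_apply, h.vectorOutput_coeFn_eq_inner _ hs, h.vectorOutput_coeFn_eq_inner _ hs,
      h.vectorOutput_coeFn_eq_inner _ hs, inner_add_right]
  map_smul' c u := by
    refine Subtype.ext ?_
    change (h.memLp_vectorOutput (Lp.memLp (c • u))).toLp _ =
      c • (h.memLp_vectorOutput (Lp.memLp u)).toLp _
    rw [← MemLp.toLp_const_smul]
    refine MemLp.toLp_congr _ _ ?_
    filter_upwards [ae_mem_rhombus δ Θ] with s hs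
    rw [Pi.smul_apply, h.vectorOutput_coeFn_eq_inner _ hs, h.vectorOutput_coeFn_eq_inner _ hs,
      inner_smul_right, smul_eq_mul]

theorem exists_norm_weightedInputMap_le (h : Admissible τ δ Θ γ) :
    ∃ M : ℝ, ∀ u, ‖weightedInputMap h u‖ ≤ M * ‖u‖ := by
  obtain ⟨M, hM, hle⟩ := h.exists_lintegral_vectorOutput_le
  refine ⟨Real.sqrt M.toReal, fun u => ?_⟩
  have h1 : ‖weightedInputMap h u‖ₑ ^ 2 ≤ M * ‖u‖ₑ ^ 2 := by
    have h2 := hle u (Lp.memLp u)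
    rw [Lp.toLp_coeFn, ← enorm_bergmanOutput_sq h (Lp.memLp u)] at h2
    exact h2
  have h2 := ENNReal.toReal_mono (ENNReal.mul_ne_top hM (ENNReal.pow_ne_top enorm_ne_top)) h1
  simp only [ENNReal.toReal_mul, ENNReal.toReal_pow, toReal_enorm] at h2
  refine (abs_le_of_sq_le_sq' ?_ (by positivity)).2
  rw [mul_pow, Real.sq_sqrt ENNReal.toReal_nonneg]
  exact h2

theorem summable_norm_weightedInputMap_sq (h : Admissible τ δ Θ γ) {ι : Type*}
    (b : HilbertBasis ι ℂ (InputSpace τ)) : Summable fun i => ‖weightedInputMap h (b i)‖ ^ 2 := by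
  refine summable_norm_bergmanOutput_sq h (fun i => Lp.memLp (b i)) ENNReal.one_ne_top
    fun s hs F => ?_
  rw [one_mul, ← enorm_toLp_sq (h.memLp_vectorKernel hs), enorm_sq_eq_ofReal]
  simp_rw [h.vectorOutput_coeFn_eq_inner _ hs, enorm_sq_eq_ofReal]
  rw [← ENNReal.ofReal_sum_of_nonneg fun _ _ => sq_nonneg _]
  refine ENNReal.ofReal_le_ofReal ?_
  simp_rw [norm_inner_symm _ (b _)]
  exact b.orthonormal.sum_inner_products_le _

end Output

/-! ### Exponential inputs -/

/-- The input `w` at one endpoint, `j = 0` for `0` and `j = 1` for `π`, and `0` at the other. -/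
def singleInput (j : Fin 2) (w : ℝ → ℂ) (t : ℝ) : EuclideanSpace ℂ (Fin 2) :=
  EuclideanSpace.single j (w t)

theorem memLp_singleInput_exp (τ κ : ℝ) (j : Fin 2) (n : ℤ) :
    MemLp (singleInput j fun t => exp (I * n * κ * t)) 2 (volume.restrict (Icc 0 τ)) := by
  have hc : Continuous (singleInput j fun t : ℝ => exp (I * n * κ * t)) := by
    refine (PiLp.continuous_toLp 2 _).comp (continuous_pi fun i => ?_)
    by_cases hi : i = j
    · subst hi; simp only [Pi.single_eq_same]; fun_prop
    · simp only [Pi.single_eq_of_ne hi]; fun_prop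
  refine MemLp.of_bound hc.aestronglyMeasurable 1 (Filter.Eventually.of_forall fun t => ?_)
  rw [singleInput, PiLp.norm_single,
    show I * (n : ℂ) * κ * t = ((n * κ * t : ℝ) : ℂ) * I by push_cast; ring, norm_exp_ofReal_mul_I]

theorem summable_norm_bergmanOutput_exp_sq {τ δ Θ γ κ : ℝ} (h : Admissible τ δ Θ γ) (hκ : 0 < κ)
    (j : Fin 2) :
    Summable fun n : ℤ => ‖bergmanOutput h _ (memLp_singleInput_exp τ κ j n)‖ ^ 2 := by
  obtain ⟨C, hC, hbes⟩ := exists_tsum_enorm_integral_mul_exp_le hκ h.pos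
  refine summable_norm_bergmanOutput_sq h _ hC fun s hs F => ?_
  simp_rw [enorm_vectorKernel_sq]
  refine (ENNReal.sum_le_tsum F).trans ?_
  fin_cases j
  · have e : ∀ n : ℤ, vectorOutput τ γ (singleInput 0 fun t => exp (I * n * κ * t)) s =
        ∫ t in (0 : ℝ)..τ, inputKernel τ γ s t * exp (I * n * κ * t) := fun n => by
      simp [vectorOutput, singleInput, output]
    simp only [Fin.zero_eta, e]
    refine (hbes _ (h.memLp_inputKernel hs)).trans (mul_le_mul' le_rfl ?_)
    exact lintegral_mono fun σ => le_self_add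
  · have e : ∀ n : ℤ, vectorOutput τ γ (singleInput 1 fun t => exp (I * n * κ * t)) s =
        ∫ t in (0 : ℝ)..τ, inputKernel τ γ (Real.pi - s) t * exp (I * n * κ * t) := fun n => by
      simp [vectorOutput, singleInput, output]
    simp only [Fin.mk_one, e]
    refine (hbes _ (h.memLp_inputKernel (pi_sub_mem_rhombus.2 hs))).trans (mul_le_mul' le_rfl ?_)
    exact lintegral_mono fun σ => le_add_self

theorem weighted_singleInput_zero (τ γ κ : ℝ) (n : ℤ) :
    weighted τ γ (singleInput 0 fun t => exp (I * n * κ * t)) =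
      fun t => !₂[weightedExp τ γ κ n t, 0] := by
  funext t
  ext i
  fin_cases i <;> simp [weighted, singleInput, weightedExp]

theorem weighted_singleInput_one (τ γ κ : ℝ) (n : ℤ) :
    weighted τ γ (singleInput 1 fun t => exp (I * n * κ * t)) =
      fun t => !₂[0, weightedExp τ γ κ n t] := by
  funext t
  ext i
  fin_cases i <;> simp [weighted, singleInput, weightedExp]

end DirichletHeat
end

theorem proposition5p4 (τ δ Θ γ : ℝ) (hτ : 0 < τ) (hδ : δ ∈ Set.Ioo (0 : ℝ) 1)
    (hΘ : Θ ∈ Set.Ioo (0 : ℝ) (Real.pi / 4)) (hγ : γ ∈ Set.Ico (0 : ℝ) (δ / 4)) :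
    -- the boundary value problem is well posed for the inputs `u_γ`, `u ∈ L²`
    (∀ u : DirichletHeat.InputSpace τ,
      (∃ z, DirichletHeat.IsSolution τ (DirichletHeat.weighted τ γ u) z) ∧
      ∀ z₁ z₂, DirichletHeat.IsSolution τ (DirichletHeat.weighted τ γ u) z₁ →
        DirichletHeat.IsSolution τ (DirichletHeat.weighted τ γ u) z₂ →
        Set.EqOn z₁ z₂ (Set.Icc 0 τ)) ∧
    -- the two series of squared norms converge
    (∀ κ : ℝ, κ = τ / (2 * Real.pi) ∨ κ = 2 * Real.pi / τ →
      ∃ f₀ fπ : ℤ → DirichletHeat.bergman δ Θ,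
        (∀ n, DirichletHeat.IsTrace (f₀ n) (DirichletHeat.inputMap τ
          fun t => !₂[DirichletHeat.weightedExp τ γ κ n t, 0])) ∧
        (∀ n, DirichletHeat.IsTrace (fπ n) (DirichletHeat.inputMap τ
          fun t => !₂[0, DirichletHeat.weightedExp τ γ κ n t])) ∧
        Summable (fun n => ‖f₀ n‖ ^ 2) ∧ Summable (fun n => ‖fπ n‖ ^ 2)) ∧
    -- the weighted input map is Hilbert–Schmidt
    ∃ L : DirichletHeat.InputSpace τ →L[ℂ] DirichletHeat.bergman δ Θ,
      (∀ u : DirichletHeat.InputSpace τ,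
        DirichletHeat.IsTrace (L u)
          (DirichletHeat.inputMap τ (DirichletHeat.weighted τ γ u))) ∧
      DirichletHeat.IsHilbertSchmidt L := by
  have h : DirichletHeat.Admissible τ δ Θ γ := ⟨hτ, hδ, hΘ, hγ⟩
  refine ⟨fun u => ⟨⟨_, DirichletHeat.isSolution_solution hτ hγ.1 h.gamma_lt (Lp.memLp u)⟩,
    fun z₁ z₂ h₁ h₂ => h₁.eqOn hτ.le h₂⟩, fun κ hκ => ?_, ?_⟩
  · have hκ0 : 0 < κ := by
      have := Real.pi_pos
      rcases hκ with rfl | rfl <;> positivity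
    refine ⟨fun n => DirichletHeat.bergmanOutput h _ (DirichletHeat.memLp_singleInput_exp τ κ 0 n),
      fun n => DirichletHeat.bergmanOutput h _ (DirichletHeat.memLp_singleInput_exp τ κ 1 n),
      fun n => ?_, fun n => ?_, DirichletHeat.summable_norm_bergmanOutput_exp_sq h hκ0 0,
      DirichletHeat.summable_norm_bergmanOutput_exp_sq h hκ0 1⟩
    · rw [← DirichletHeat.weighted_singleInput_zero]
      exact DirichletHeat.isTrace_bergmanOutput h _
    · rw [← DirichletHeat.weighted_singleInput_one]
      exact DirichletHeat.isTrace_bergmanOutput h _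
  · obtain ⟨M, hM⟩ := DirichletHeat.exists_norm_weightedInputMap_le h
    exact ⟨(DirichletHeat.weightedInputMap h).mkContinuous M hM,
      fun u => DirichletHeat.isTrace_bergmanOutput h (Lp.memLp u),
      fun ι b => DirichletHeat.summable_norm_weightedInputMap_sq h b⟩
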